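/- Let $n\ge 1$ and let $\mathbb D^n$ be the unit polydisk in $\mathbb C^n$. For $L=(L_1,\dots,L_n)$ with all $L_j>0$ let $$f_L(z)=\sum_{\alpha\in\mathbb N^n} a_\alpha\prod_{j=1}^n\Bigl(\frac{\Gamma(L_j+\alpha_j)}{\alpha_j!\,\Gamma(L_j)}\Bigr)^{1/2}z^\alpha ,\qquad z\in\mathbb D^n,$$ where the $a_\alpha$ are i.i.d. standard complex Gaussian variables (density $\pi^{-1}e^{-|\zeta|^2}$ on $\mathbb C$). Let $[Z_{f_L}]=\frac{i}{2\pi}\partial\bar\partial\log|f_L|^2$ be the integration current over the zero variety of $f_L$, and for a real-valued, compactly supported $\mathcal C^2$ form $\varphi$ of bidegree $(n-1,n-1)$ on $\mathbb D^n$ put $$I_L(\varphi)=\int_{Z_{f_L}}\varphi=\int_{\mathbb D^n}\varphi\wedge[Z_{f_L}]=\int_{\mathbb D^n}\log|f_L|^2\,\frac{i}{2\pi}\partial\bar\partial\varphi .$$ For every such form $\varphi$ and every $\delta>0$: (i) There exist $c>0$ and $L_1^0,\dots,L_n^0$, depending only on $\varphi,\delta,n$, such that whenever $L_j\ge L_j^0$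 for all $j$, the variable $I_L(\varphi)$ is integrable and $$\mathbb P\Bigl[\bigl|I_L(\varphi)-\mathbb E[I_L(\varphi)]\bigr|>\delta\sum_{j=1}^n L_j\Bigr]\le \exp\Bigl(-c\Bigl(\sum_{j=1}^n L_j\Bigr)\Bigl(\prod_{j=1}^n L_j\Bigr)\Bigr).$$ (ii) For every $\kappa>0$ there exist $c>0$ and $L_1^0,\dots,L_n^0$, depending only on $\varphi,\delta,\kappa,n$, such that whenever $L_j\ge L_j^0$ for all $j$ and $\mathbb E[I_L(\varphi)]\ge\kappa\sum_{j=1}^n L_j$, $$\mathbb P\Bigl[\bigl|I_L(\varphi)-\mathbb E[I_L(\varphi)]\bigr|>\delta\,\mathbb E[I_L(\varphi)]\Bigr]\le \exp\Bigl(-c\Bigl(\sum_{j=1}^n L_j\Bigr)\Bigl(\prod_{j=1}^n L_j\Bigr)\Bigr).$$ -/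

import Mathlib

open MeasureTheory ProbabilityTheory

noncomputable section

namespace PolydiskGAF

/-- The unit polydisk in `ℂⁿ`. -/
def polydisk (n : ℕ) : Set (Fin n → ℂ) := {z | ∀ j, ‖z j‖ < 1}

/-- Real-valued differential forms of degree `k` on `ℂⁿ` (regarded as a real vector space). -/
abbrev RealForm (n k : ℕ) : Type := (Fin n → ℂ) → (Fin n → ℂ) [⋀^Fin k]→L[ℝ] ℝ

/-- A real form of bidegree `(p,p)`, where the degree is `2p`. In total degree `2p`, the component
of bidegree `(p + q, p - q)` is multiplied by `c ^ (2q)` when all arguments are multiplied by the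
unit complex number `c`, so bidegree `(p,p)` means invariance under all such rotations. -/
def IsOfBidegreePP {n p : ℕ} (φ : RealForm n (2 * p)) : Prop :=
  ∀ z : Fin n → ℂ, ∀ c : ℂ, ‖c‖ = 1 → ∀ v : Fin (2 * p) → (Fin n → ℂ),
    φ z (fun i => c • v i) = φ z v

/-- The space of real-valued, compactly supported `C²` forms of bidegree `(n-1,n-1)` on the unit
polydisk (extended by zero to `ℂⁿ`). -/
structure IsTestForm {n : ℕ} (φ : RealForm n (2 * (n - 1))) : Prop where
  contDiff : ContDiff ℝ 2 φ
  hasCompactSupport : HasCompactSupport φ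
  tsupport_subset : tsupport φ ⊆ polydisk n
  bidegree : IsOfBidegreePP φ

/-- Multiplication by `i` on `ℂⁿ`, as a real-linear map. -/
def mulI (n : ℕ) : (Fin n → ℂ) →L[ℝ] (Fin n → ℂ) :=
  Complex.I • ContinuousLinearMap.id ℝ (Fin n → ℂ)

/-- The action of the complex structure on forms: `(J^* η)(v₁, …, v_k) = η(i v₁, …, i v_k)`.
It multiplies a form of bidegree `(a,b)` by `i ^ (a - b)`. -/
def jPullback {n k : ℕ} (η : RealForm n k) : RealForm n k :=
  fun z => (η z).compContinuousLinearMap (mulI n)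

/-- `i ∂∂̄ φ` for a real form `φ` of bidegree `(p,p)`. Since `dφ = ∂φ + ∂̄φ` has components of
bidegrees `(p+1,p)` and `(p,p+1)`, one has `J^* dφ = i ∂φ - i ∂̄φ` and hence
`d (J^* dφ) = -2 i ∂∂̄ φ`. -/
def iDDbar {n k : ℕ} (φ : RealForm n k) : RealForm n (k + 1 + 1) :=
  fun z => (-(1 / 2 : ℝ)) • extDeriv (jPullback (extDeriv φ)) z

/-- The positively oriented real frame `e₁, i e₁, e₂, i e₂, …` of `ℂⁿ`. -/
def stdFrame (n k : ℕ) (i : Fin k) : Fin n → ℂ :=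
  fun j => if (j : ℕ) = (i : ℕ) / 2 then (if (i : ℕ) % 2 = 0 then 1 else Complex.I) else 0

/-- The integral `∫ u η` over the polydisk of a function `u` against a form `η` of top degree
(`k = 2n`). The volume form of Lebesgue measure takes the value one on the standard frame. -/
def integralTop {n k : ℕ} (u : (Fin n → ℂ) → ℝ) (η : RealForm n k) : ℝ :=
  ∫ z in polydisk n, u z * η z (stdFrame n k)

/-- The current `(i / 2π) ∂∂̄ u` of a locally integrable function `u` on the polydisk, acting on
test forms `φ` of bidegree `(n-1,n-1)`: `∫ φ ∧ (i / 2π) ∂∂̄ u := ∫ u (i / 2π) ∂∂̄ φ`. -/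
def ddbarCurrent {n : ℕ} (u : (Fin n → ℂ) → ℝ) (φ : RealForm n (2 * (n - 1))) : ℝ :=
  (1 / (2 * Real.pi)) * integralTop u (iDDbar φ)

/-- The integration current `[Z_f] = (i / 2π) ∂∂̄ log |f|²` over the zero variety of a holomorphic
function `f` (not identically zero) on the polydisk. -/
def zeroCurrent {n : ℕ} (f : (Fin n → ℂ) → ℂ) (φ : RealForm n (2 * (n - 1))) : ℝ :=
  ddbarCurrent (fun z => Real.log (‖f z‖ ^ 2)) φ

/-- The standard complex Gaussian law `N_ℂ(0,1)`, with density `exp(-|z|²) / π`. -/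
def stdComplexGaussian : Measure ℂ :=
  volume.withDensity fun z => ENNReal.ofReal (Real.exp (-‖z‖ ^ 2) / Real.pi)

/-- The family `a` consists of independent `N_ℂ(0,1)` random variables. -/
structure IsIIDStdComplexGaussian {ι Ω : Type*} [MeasurableSpace Ω] (a : ι → Ω → ℂ)
    (P : Measure Ω) : Prop where
  measurable : ∀ α, Measurable (a α)
  law : ∀ α, P.map (a α) = stdComplexGaussian
  indep : iIndepFun a P

/-- The function `∑_α a_α ∏_j (Γ(L_j + α_j) / (α_j! Γ(L_j)))^{1/2} z^α`; for independent `N_ℂ(0,1)`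
coefficients `a_α` this is the hyperbolic Gaussian analytic function of intensity `L`. -/
def hyperbolicGAF {n : ℕ} (L : Fin n → ℝ) (a : (Fin n → ℕ) → ℂ) (z : Fin n → ℂ) : ℂ :=
  ∑' α : Fin n → ℕ, a α *
    ∏ j, ((Real.sqrt (Real.Gamma (L j + α j) / ((α j).factorial * Real.Gamma (L j))) : ℝ) : ℂ)
      * z j ^ α j

/-- The linear statistic `I_L(φ) = ∫ φ ∧ [Z_{f_L}]`, as a random variable. -/
def linStat {n : ℕ} {Ω : Type*} (a : (Fin n → ℕ) → Ω → ℂ) (L : Fin n → ℝ)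
    (φ : RealForm n (2 * (n - 1))) (ω : Ω) : ℝ :=
  zeroCurrent (hyperbolicGAF L fun α => a α ω) φ

end PolydiskGAF

end

noncomputable section

namespace PolydiskGAF

open scoped ComplexConjugate ENNReal
open Filter Topology

/-! Write `X = f_L · K(z,z)^{-1/2}` for the normalized field (`normGAF`). At each point of the
polydisk `X` is a standard complex Gaussian, and `log |f_L|²` differs from `log |X|²` by a
deterministic term that cancels on subtracting the mean. Thus the deviation of the statistic is
`1/(2π)` times the integral of `log |X|² - E log |ζ|²` against the bounded density of `i∂∂̄φ`
(`integrable_linStat_and_deviation`). It is enough to bound the probability that the integral of the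
positive or of the negative part of `log |X|²` exceeds `ε s`. Here `s = ∑ L_j` and `R = ∏ L_j`, and
the target is `exp(-c s R)`.

Positive part (`measure_posLog_ge_le`): only one-point laws enter. Jensen and Chebyshev with
exponent `p ≈ R` give `exp(-p ε s / V)` times a moment of size at most `(6p)^p`, where `V` is the
volume of the polydisk. Since `log(6p) = O(1 + n log s)` is negligible against `s`, the exponential
wins.

Negative part (`measure_negLog_ge_le`): large exponents are not available, because `|ζ|^{-q}` is
integrable only for `q < 2`. The gain comes from near independence. The kernel of `X` decays like
`exp(-L_j |z_j - w_j|² / 8)` in each variable (`norm_normKernel_le`), so on a lattice of spacing `M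
/ √L_j` the Gram matrix dominates half the identity. The values there have the law of a Gaussian
vector plus independent noise of variance `1/2`, and conditioning on the former bounds the expected
product of `max(1, |X|⁻¹)` by a constant to the number of points, which is `O(R)`
(`IsIIDStdComplexGaussian.lintegral_prod_max_one_inv_norm_le`). Averaging over translates of the
lattice recovers the full integral, again by Jensen.

The law of a finite vector of values is identified through its Gram matrix
(`map_eq_map_of_gram_eq`). Part (ii) is part (i) at level `δκ`. -/

/-! ### Multi-index power series and the binomial series. -/

theorem summable_norm_hasSum_prod_fin {n : ℕ} (f : Fin n → ℕ → ℂ)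
    (hf : ∀ j, Summable fun k => ‖f j k‖) :
    (Summable fun α : Fin n → ℕ => ‖∏ j, f j (α j)‖) ∧
      HasSum (fun α : Fin n → ℕ => ∏ j, f j (α j)) (∏ j, ∑' k, f j k) := by
  induction n with
  | zero =>
    refine ⟨Summable.of_finite, ?_⟩
    convert hasSum_fintype (fun α : Fin 0 → ℕ => ∏ j, f j (α j))
    simp
  | succ n ih =>
    obtain ⟨h1, h2⟩ := ih (fun j => f j.succ) (fun j => hf j.succ)
    let E : ℕ × (Fin n → ℕ) ≃ (Fin (n + 1) → ℕ) :=
      ⟨fun p => Fin.cons p.1 p.2, fun a => (a 0, Fin.tail a), fun p => by simp, fun a => by simp⟩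
    have e : ∀ α : ℕ × (Fin n → ℕ), (∏ j, f j (E α j))
        = f 0 α.1 * ∏ j : Fin n, f j.succ (α.2 j) := fun α => by
      simp [E, Fin.prod_univ_succ]
    generalize hF : (fun α : Fin n → ℕ => ∏ j : Fin n, f j.succ (α j)) = F at *
    have hF' : ∀ α, ∏ j : Fin n, f j.succ (α j) = F α := fun α => by rw [← hF]
    simp only [hF'] at h1 e
    have h3 : Summable fun x : ℕ × (Fin n → ℕ) => f 0 x.1 * F x.2 :=
      summable_mul_of_summable_norm (hf 0) h1
    constructor
    · rw [← E.summable_iff]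
      simp only [Function.comp_def, e]
      exact h3.norm
    · rw [← E.hasSum_iff, Fin.prod_univ_succ]
      simp only [Function.comp_def, e]
      exact (hf 0).of_norm.hasSum.mul h2 h3

/-- Identifies the squared coefficients as those of the binomial series of `(1 - x)^{-l}`, which is
what gives the covariance kernel its closed form. -/
theorem gamma_ratio_eq_choose {l : ℝ} (hl : 0 < l) (k : ℕ) :
    Real.Gamma (l + k) / (k.factorial * Real.Gamma l) = Ring.choose (l + k - 1) k := by
  have h0 : ∀ k : ℕ, Real.Gamma (l + k) = (ascPochhammer ℝ k).eval l * Real.Gamma l := by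
    intro k
    induction k with
    | zero => simp
    | succ k ih =>
      have : l + (k + 1 : ℕ) = (l + k) + 1 := by push_cast; ring
      rw [this, Real.Gamma_add_one (by positivity), ih, ascPochhammer_succ_right]
      simp; ring
  have h1 := Ring.factorial_nsmul_multichoose_eq_ascPochhammer l k
  rw [h0, Ring.choose, show l + k - 1 - k + 1 = l by ring]
  have hg := (Real.Gamma_pos_of_pos hl).ne'
  have hk : (k.factorial : ℝ) ≠ 0 := by positivity
  rw [nsmul_eq_mul, Polynomial.ascPochhammer_smeval_eq_eval] at h1
  rw [← h1]
  field_simp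

theorem hasSum_gamma_ratio {l : ℝ} (hl : 0 < l) {x : ℂ} (hx : ‖x‖ < 1) :
    HasSum (fun k : ℕ => ((Real.Gamma (l + k) / (k.factorial * Real.Gamma l) : ℝ) : ℂ) * x ^ k)
      (1 / (1 - x) ^ (l : ℂ)) := by
  have h := (Complex.one_div_one_sub_cpow_hasFPowerSeriesOnBall_zero (l : ℂ)).hasSum
    (y := x) (by simpa [enorm_eq_nnnorm, ← NNReal.coe_lt_coe] using hx)
  simp only [FormalMultilinearSeries.ofScalars_apply_eq, zero_add, smul_eq_mul] at h
  convert! h using 2 with k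
  rw [gamma_ratio_eq_choose hl, Complex.ofReal_choose]
  push_cast
  rfl

theorem gamma_ratio_nonneg {l : ℝ} (hl : 0 < l) (k : ℕ) :
    0 ≤ Real.Gamma (l + k) / (k.factorial * Real.Gamma l) := by
  have := Real.Gamma_pos_of_pos hl
  have := Real.Gamma_pos_of_pos (show 0 < l + k by positivity)
  positivity

theorem summable_gamma_ratio {l : ℝ} (hl : 0 < l) {r : ℝ} (h0 : 0 ≤ r) (hr : r < 1) :
    Summable fun k : ℕ => Real.Gamma (l + k) / (k.factorial * Real.Gamma l) * r ^ k := by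
  have := (hasSum_gamma_ratio hl (x := (r : ℂ)) (by simpa [abs_of_nonneg h0] using hr)).summable
  exact_mod_cast this

theorem summable_sqrt_gamma_ratio {l : ℝ} (hl : 0 < l) {z : ℂ} (hz : ‖z‖ < 1) :
    Summable fun k : ℕ =>
      ‖((√(Real.Gamma (l + k) / (k.factorial * Real.Gamma l)) : ℝ) : ℂ) * z ^ k‖ := by
  refine Summable.of_nonneg_of_le (fun _ => norm_nonneg _) (fun k => ?_)
    ((summable_gamma_ratio hl (norm_nonneg z) hz).add
      (summable_geometric_of_lt_one (norm_nonneg z) hz))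
  have hc := gamma_ratio_nonneg hl k
  set c := Real.Gamma (l + k) / (k.factorial * Real.Gamma l)
  have : √c ≤ c + 1 := by nlinarith [Real.sq_sqrt hc, Real.sqrt_nonneg c, sq_nonneg (√c - 1)]
  simp only [norm_mul, Complex.norm_real, norm_pow, Real.norm_eq_abs,
    abs_of_nonneg (Real.sqrt_nonneg c)]
  nlinarith [pow_nonneg (norm_nonneg z) k]

/-! ### The normalized covariance kernel and its decay. -/

/-- `K(z,z)^{-1/2}` for the covariance kernel `K` of the hyperbolic GAF. -/
def normFactor {n : ℕ} (L : Fin n → ℝ) (z : Fin n → ℂ) : ℝ := ∏ j, (1 - ‖z j‖ ^ 2) ^ (L j / 2)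

/-- The coefficients of the normalized hyperbolic GAF at the point `z`. -/
def normCoeff {n : ℕ} (L : Fin n → ℝ) (α : Fin n → ℕ) (z : Fin n → ℂ) : ℂ :=
  (∏ j, ((√(Real.Gamma (L j + α j) / ((α j).factorial * Real.Gamma (L j))) : ℝ) : ℂ) * z j ^ α j)
    * (normFactor L z : ℝ)

/-- The covariance kernel of the normalized hyperbolic GAF. -/
def normKernel {n : ℕ} (L : Fin n → ℝ) (z w : Fin n → ℂ) : ℂ :=
  (∏ j, 1 / (1 - z j * conj (w j)) ^ (L j : ℂ)) * (normFactor L z : ℝ) * (normFactor L w : ℝ)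

section Kernel

variable {n : ℕ} {L : Fin n → ℝ}

theorem summable_norm_normCoeff (hL : ∀ j, 0 < L j) {z : Fin n → ℂ} (hz : z ∈ polydisk n) :
    Summable fun α => ‖normCoeff L α z‖ := by
  have := (summable_norm_hasSum_prod_fin (fun j (k : ℕ) =>
    ((√(Real.Gamma (L j + k) / (k.factorial * Real.Gamma (L j))) : ℝ) : ℂ) * z j ^ k)
    (fun j => summable_sqrt_gamma_ratio (hL j) (hz j))).1
  simp only [normCoeff, norm_mul _ ((normFactor L z : ℝ) : ℂ)]
  exact this.mul_right _

theorem norm_mul_conj_lt_one {z w : ℂ} (hz : ‖z‖ < 1) (hw : ‖w‖ < 1) : ‖z * conj w‖ < 1 := by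
  rw [norm_mul, RCLike.norm_conj]
  exact mul_lt_one_of_nonneg_of_lt_one_left (norm_nonneg _) hz hw.le

theorem hasSum_normCoeff_mul_conj (hL : ∀ j, 0 < L j) {z w : Fin n → ℂ} (hz : z ∈ polydisk n)
    (hw : w ∈ polydisk n) :
    HasSum (fun α => normCoeff L α z * conj (normCoeff L α w)) (normKernel L z w) := by
  have key := fun j => hasSum_gamma_ratio (hL j) (norm_mul_conj_lt_one (hz j) (hw j))
  have h := (summable_norm_hasSum_prod_fin (fun j (k : ℕ) =>
    ((Real.Gamma (L j + k) / (k.factorial * Real.Gamma (L j)) : ℝ) : ℂ) * (z j * conj (w j)) ^ k)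
    (fun j => (key j).summable.norm)).2
  have h2 := (h.mul_right ((normFactor L z : ℝ) : ℂ)).mul_right ((normFactor L w : ℝ) : ℂ)
  rw [Finset.prod_congr rfl fun j _ => (key j).tsum_eq] at h2
  convert! h2 using 2 with α
  simp only [normCoeff, map_mul, map_prod, map_pow, Complex.conj_ofReal]
  have : ∀ j, ((Real.Gamma (L j + α j) / ((α j).factorial * Real.Gamma (L j)) : ℝ) : ℂ) *
      (z j * conj (w j)) ^ α j =
      (((√(Real.Gamma (L j + α j) / ((α j).factorial * Real.Gamma (L j))) : ℝ) : ℂ) * z j ^ α j) *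
      (((√(Real.Gamma (L j + α j) / ((α j).factorial * Real.Gamma (L j))) : ℝ) : ℂ) *
        conj (w j) ^ α j) := by
    intro j
    nth_rewrite 1 [← Real.mul_self_sqrt (gamma_ratio_nonneg (hL j) (α j))]
    push_cast; ring
  simp only [this, Finset.prod_mul_distrib]
  ring

/-- From `|1 - z w̄|² = (1 - |z|²)(1 - |w|²) + |z - w|²`, each factor equals `(1 - |z - w|² / |1 - z
w̄|²)^{L/2}`. Then `|1 - z w̄| ≤ 2` and `1 - t ≤ e^{-t}` apply. The bound does not degenerate at the
boundary, so the whole polydisk can be treated at once. -/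
theorem norm_normKernel_le (hL : ∀ j, 0 < L j) {z w : Fin n → ℂ} (hz : z ∈ polydisk n)
    (hw : w ∈ polydisk n) :
    ‖normKernel L z w‖ ≤ ∏ j, Real.exp (-(L j * ‖z j - w j‖ ^ 2 / 8)) := by
  rw [normKernel, normFactor, normFactor]
  simp only [norm_mul, norm_prod, Complex.norm_real, ← Finset.prod_mul_distrib]
  refine Finset.prod_le_prod (fun _ _ => by positivity) fun j _ => ?_
  have hz' := hz j
  have hw' := hw j
  have h1 : 0 < 1 - ‖z j‖ ^ 2 := by nlinarith [norm_nonneg (z j)]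
  have h2 : 0 < 1 - ‖w j‖ ^ 2 := by nlinarith [norm_nonneg (w j)]
  have hn := norm_mul_conj_lt_one hz' hw'
  have h3 : 0 < ‖1 - z j * conj (w j)‖ := by
    rw [norm_pos_iff, sub_ne_zero]
    intro h; rw [← h] at hn; simp at hn
  have h4 : ‖1 - z j * conj (w j)‖ ≤ 2 := by
    refine (norm_sub_le _ _).trans ?_
    simp only [norm_one]; linarith
  have id1 : ‖1 - z j * conj (w j)‖ ^ 2 = (1 - ‖z j‖ ^ 2) * (1 - ‖w j‖ ^ 2) + ‖z j - w j‖ ^ 2 := by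
    simp only [Complex.sq_norm, Complex.normSq_apply]
    simp; ring
  have e1 : ‖(1 - z j * conj (w j)) ^ (L j : ℂ)‖ = ‖1 - z j * conj (w j)‖ ^ (L j) :=
    Complex.norm_cpow_real _ _
  rw [norm_div, e1, Real.norm_of_nonneg (Real.rpow_nonneg h1.le _),
    Real.norm_of_nonneg (Real.rpow_nonneg h2.le _), norm_one, mul_assoc,
    ← Real.mul_rpow h1.le h2.le]
  have e2 : ‖1 - z j * conj (w j)‖ ^ (L j) = (‖1 - z j * conj (w j)‖ ^ 2) ^ (L j / 2) := by
    rw [← Real.rpow_natCast, ← Real.rpow_mul (norm_nonneg _)]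
    congr 1; push_cast; ring
  rw [e2, one_div_mul_eq_div, ← Real.div_rpow (by positivity) (by positivity),
    show -(L j * ‖z j - w j‖ ^ 2 / 8) = -(‖z j - w j‖ ^ 2 / 4) * (L j / 2) by ring, Real.exp_mul]
  refine Real.rpow_le_rpow (by positivity) ?_ (by have := hL j; positivity)
  have h5 := Real.add_one_le_exp (-(‖z j - w j‖ ^ 2 / 4))
  refine le_trans ?_ h5
  rw [div_le_iff₀ (by positivity)]
  have : ‖1 - z j * conj (w j)‖ ^ 2 ≤ 4 := by nlinarith
  nlinarith [sq_nonneg ‖z j - w j‖]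

theorem normKernel_self {z : Fin n → ℂ} (hz : z ∈ polydisk n) :
    normKernel L z z = 1 := by
  rw [normKernel, normFactor]
  push_cast
  simp only [← Finset.prod_mul_distrib]
  refine Finset.prod_eq_one fun j _ => ?_
  have hz' := hz j
  have h1 : 0 < 1 - ‖z j‖ ^ 2 := by nlinarith [norm_nonneg (z j)]
  have e : (1 - z j * conj (z j)) = ((1 - ‖z j‖ ^ 2 : ℝ) : ℂ) := by
    rw [Complex.mul_conj, Complex.normSq_eq_norm_sq]; push_cast; ring
  rw [e, ← Complex.ofReal_cpow h1.le]
  norm_cast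
  rw [mul_assoc, ← Real.rpow_add h1, add_halves, one_div_mul_cancel]
  exact (Real.rpow_pos_of_pos h1 _).ne'

theorem normFactor_pos {z : Fin n → ℂ} (hz : z ∈ polydisk n) : 0 < normFactor L z :=
  Finset.prod_pos fun j _ => Real.rpow_pos_of_pos
    (by have := hz j; nlinarith [norm_nonneg (z j)]) _

end Kernel

/-! ### Integrals against the standard complex Gaussian law. -/

theorem measurable_gaussianDensity :
    Measurable fun z : ℂ => ENNReal.ofReal (Real.exp (-‖z‖ ^ 2) / Real.pi) := by
  fun_prop

theorem lintegral_stdComplexGaussian {F : ℂ → ℝ≥0∞} (hF : Measurable F) :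
    ∫⁻ z, F z ∂stdComplexGaussian =
      ∫⁻ z, ENNReal.ofReal (Real.exp (-‖z‖ ^ 2) / Real.pi) * F z := by
  rw [stdComplexGaussian, lintegral_withDensity_eq_lintegral_mul _ measurable_gaussianDensity hF]
  rfl

theorem lintegral_exp_neg_mul_norm_sq {b : ℝ} (hb : 0 < b) :
    ∫⁻ z : ℂ, ENNReal.ofReal (Real.exp (-b * ‖z‖ ^ 2)) = ENNReal.ofReal (Real.pi / b) := by
  have h := GaussianFourier.integral_rexp_neg_mul_sq_norm (V := ℂ) hb
  simp only [Complex.finrank_real_complex, Nat.cast_ofNat, div_self (two_ne_zero' ℝ),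
    Real.rpow_one] at h
  rw [← h, ofReal_integral_eq_lintegral_ofReal _ (ae_of_all _ fun _ => (Real.exp_pos _).le)]
  by_contra hn
  rw [integral_undef hn] at h
  have := div_pos Real.pi_pos hb
  linarith

theorem lintegral_exp_half_norm_sq :
    ∫⁻ z, ENNReal.ofReal (Real.exp (‖z‖ ^ 2 / 2)) ∂stdComplexGaussian = 2 := by
  rw [lintegral_stdComplexGaussian (by fun_prop)]
  have : ∀ z : ℂ, ENNReal.ofReal (Real.exp (-‖z‖ ^ 2) / Real.pi) *
      ENNReal.ofReal (Real.exp (‖z‖ ^ 2 / 2)) =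
      ENNReal.ofReal (1 / Real.pi) * ENNReal.ofReal (Real.exp (-(1 / 2) * ‖z‖ ^ 2)) := by
    intro z
    have hpi := Real.pi_pos
    rw [← ENNReal.ofReal_mul (by positivity), ← ENNReal.ofReal_mul (by positivity),
      div_mul_eq_mul_div, ← Real.exp_add, one_div_mul_eq_div]
    congr 3; ring
  simp_rw [this]
  rw [lintegral_const_mul _ (by fun_prop), lintegral_exp_neg_mul_norm_sq (by norm_num),
    ← ENNReal.ofReal_mul (by have := Real.pi_pos; positivity)]
  have : 1 / Real.pi * (Real.pi / (1 / 2)) = 2 := by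
    field_simp [Real.pi_ne_zero]
  rw [this]; simp

instance : IsProbabilityMeasure stdComplexGaussian := ⟨by
  have h := lintegral_stdComplexGaussian (F := fun _ => 1) measurable_const
  simp only [lintegral_const, one_mul, mul_one] at h
  have hpi := Real.pi_pos
  rw [h]
  have : ∀ z : ℂ, ENNReal.ofReal (Real.exp (-‖z‖ ^ 2) / Real.pi) =
      ENNReal.ofReal (1 / Real.pi) * ENNReal.ofReal (Real.exp (-1 * ‖z‖ ^ 2)) := by
    intro z
    rw [← ENNReal.ofReal_mul (by positivity), one_div_mul_eq_div]
    congr 3; ring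
  simp_rw [this]
  rw [lintegral_const_mul _ (by fun_prop), lintegral_exp_neg_mul_norm_sq one_pos,
    ← ENNReal.ofReal_mul (by positivity)]
  simp [Real.pi_ne_zero]⟩

/-- A bound for `E max(1, |b + ζ|⁻¹)`, uniform in `b`, for a standard complex Gaussian `ζ`. -/
def singConst : ℝ≥0∞ :=
  1 + ∫⁻ z : ℂ, (Metric.ball 0 1).indicator (fun z => ENNReal.ofReal ‖z‖⁻¹) z

theorem singConst_ne_top : singConst ≠ ∞ := by
  refine ENNReal.add_ne_top.2 ⟨ENNReal.one_ne_top, ?_⟩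
  rw [lintegral_indicator Metric.isOpen_ball.measurableSet]
  have : IntegrableOn (fun z : ℂ => ‖z‖⁻¹) (Metric.ball 0 1) volume := by
    rw [integrableOn_fun_norm_addHaar volume (f := fun x : ℝ => x⁻¹)]
    refine (integrableOn_const (C := (1 : ℝ)) (by simp)).congr_fun (fun x hx => ?_)
      measurableSet_Ioo
    simp [hx.1.ne']
  exact this.lintegral_lt_top.ne

theorem one_le_singConst : 1 ≤ singConst := le_self_add

/-- The Gaussian density is at most `1` and `|z|⁻¹` is integrable near the origin of the plane;
translation invariance of Lebesgue measure makes the bound uniform in the shift, as conditioning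
later requires. -/
theorem lintegral_max_one_inv_norm_le (b : ℂ) :
    ∫⁻ z, ENNReal.ofReal (max 1 ‖b + z‖⁻¹) ∂stdComplexGaussian ≤ singConst := by
  set g : ℂ → ℝ≥0∞ := (Metric.ball 0 1).indicator (fun z => ENNReal.ofReal ‖z‖⁻¹) with hg
  have hgm : Measurable g :=
    (by fun_prop : Measurable fun z : ℂ => ENNReal.ofReal ‖z‖⁻¹).indicator
      Metric.isOpen_ball.measurableSet
  have h1 : ∀ z : ℂ, ENNReal.ofReal (max 1 ‖b + z‖⁻¹) ≤ 1 + g (b + z) := by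
    intro z
    by_cases hz : b + z ∈ Metric.ball (0 : ℂ) 1
    · rw [hg, Set.indicator_of_mem hz, ← ENNReal.ofReal_one, ← ENNReal.ofReal_add (by simp)
        (by positivity)]
      refine ENNReal.ofReal_le_ofReal (max_le ?_ ?_)
      · have : 0 ≤ ‖b + z‖⁻¹ := by positivity
        linarith
      · linarith
    · have : ‖b + z‖⁻¹ ≤ 1 := inv_le_one_of_one_le₀ (by simpa using hz)
      simp [max_eq_left this]
  calc ∫⁻ z, ENNReal.ofReal (max 1 ‖b + z‖⁻¹) ∂stdComplexGaussian
      ≤ ∫⁻ z, (1 + g (b + z)) ∂stdComplexGaussian := lintegral_mono h1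
    _ = 1 + ∫⁻ z, g (b + z) ∂stdComplexGaussian := by
        rw [lintegral_add_left measurable_const]; simp
    _ ≤ 1 + ∫⁻ z, g (b + z) := by
        gcongr 1 + ?_
        rw [lintegral_stdComplexGaussian (F := fun z => g (b + z))
          (hgm.comp (measurable_const_add b))]
        refine lintegral_mono fun z => mul_le_of_le_one_left' ?_
        rw [ENNReal.ofReal_le_one, div_le_one Real.pi_pos]
        have : Real.exp (-‖z‖ ^ 2) ≤ 1 := Real.exp_le_one_iff.2 (by nlinarith [sq_nonneg ‖z‖])
        linarith [Real.pi_gt_three]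
    _ = singConst := by rw [lintegral_add_left_eq_self g b]; rfl

theorem integrable_norm_stdComplexGaussian : Integrable (fun z : ℂ => ‖z‖) stdComplexGaussian := by
  refine ⟨by fun_prop, ?_⟩
  refine lt_of_le_of_lt (lintegral_mono fun z => ?_)
    (lintegral_exp_half_norm_sq.trans_lt (by simp : (2 : ℝ≥0∞) < ∞))
  rw [← ofReal_norm, norm_norm]
  refine ENNReal.ofReal_le_ofReal ?_
  nlinarith [Real.add_one_le_exp (‖z‖ ^ 2 / 2), sq_nonneg (‖z‖ - 1)]

theorem integrable_log_norm_sq_stdComplexGaussian :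
    Integrable (fun z : ℂ => Real.log (‖z‖ ^ 2)) stdComplexGaussian := by
  refine ⟨(Real.measurable_log.comp (by fun_prop)).aestronglyMeasurable, ?_⟩
  have hle : ∀ z : ℂ, ‖Real.log (‖z‖ ^ 2)‖ₑ ≤
      2 * ENNReal.ofReal (Real.exp (‖z‖ ^ 2 / 2)) + 2 * ENNReal.ofReal (max 1 ‖0 + z‖⁻¹) := by
    intro z
    rw [← ofReal_norm, ← ENNReal.ofReal_ofNat, ← ENNReal.ofReal_mul (by simp),
      ← ENNReal.ofReal_mul (by simp), ← ENNReal.ofReal_add (by positivity) (by positivity)]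
    refine ENNReal.ofReal_le_ofReal ?_
    rw [zero_add, Real.norm_eq_abs, abs_le]
    have h1 := Real.add_one_le_exp (‖z‖ ^ 2 / 2)
    have h2 : ‖z‖⁻¹ ≤ max 1 ‖z‖⁻¹ := le_max_right _ _
    have h3 : 0 ≤ ‖z‖⁻¹ := by positivity
    rcases eq_or_ne z 0 with rfl | hz
    · simp
    have hz : 0 < ‖z‖ := norm_pos_iff.2 hz
    have h4 := Real.log_le_sub_one_of_pos (pow_pos hz 2)
    have h5 := Real.log_le_sub_one_of_pos (inv_pos.2 hz)
    rw [Real.log_inv] at h5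
    rw [Real.log_pow] at h4 ⊢
    push_cast at *
    constructor <;> nlinarith [sq_nonneg ‖z‖]
  refine lt_of_le_of_lt (lintegral_mono hle) ?_
  rw [lintegral_add_left (by fun_prop), lintegral_const_mul _ (by fun_prop),
    lintegral_const_mul _ (by fun_prop), lintegral_exp_half_norm_sq]
  refine ENNReal.add_lt_top.2 ⟨ENNReal.mul_lt_top (by simp) (by simp),
    ENNReal.mul_lt_top (by simp) ?_⟩
  exact (lintegral_max_one_inv_norm_le 0).trans_lt singConst_ne_top.lt_top

theorem integral_cexp_re_mul_stdComplexGaussian (s : ℂ) :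
    ∫ z, Complex.exp (Complex.I * ((s * z).re : ℝ)) ∂stdComplexGaussian =
      Complex.exp (-(‖s‖ ^ 2 / 4 : ℝ)) := by
  have hpi := Real.pi_pos
  rw [stdComplexGaussian, integral_withDensity_eq_integral_toReal_smul measurable_gaussianDensity
    (by simp)]
  have h := GaussianFourier.integral_cexp_neg_mul_sq_norm_add (V := ℂ) (b := 1) (by simp)
    Complex.I (conj s)
  have e : ∀ z : ℂ, (ENNReal.ofReal (Real.exp (-‖z‖ ^ 2) / Real.pi)).toReal •
      Complex.exp (Complex.I * ((s * z).re : ℝ)) = (1 / Real.pi : ℂ) *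
      Complex.exp (-1 * (‖z‖ : ℂ) ^ 2 + Complex.I * (inner ℝ (conj s) z : ℝ)) := by
    intro z
    rw [ENNReal.toReal_ofReal (by positivity), Complex.exp_add, Complex.inner]
    simp only [Complex.real_smul, Complex.conj_conj]
    push_cast
    rw [neg_one_mul, mul_comm z s]
    ring
  simp_rw [e, integral_const_mul, h]
  simp only [Complex.finrank_real_complex]
  have : (Real.pi : ℂ) ≠ 0 := by exact_mod_cast hpi.ne'
  simp [this, Complex.I_sq, neg_div]

/-! ### Joint laws of Gaussian series. -/

section Law

variable {I Ω : Type*} [Countable I] [MeasurableSpace Ω] {P : Measure Ω} {a : I → Ω → ℂ}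

omit [Countable I] in
theorem IsIIDStdComplexGaussian.lintegral_comp (ha : IsIIDStdComplexGaussian a P) (α : I)
    {F : ℂ → ℝ≥0∞} (hF : Measurable F) :
    ∫⁻ ω, F (a α ω) ∂P = ∫⁻ z, F z ∂stdComplexGaussian := by
  rw [← ha.law α, lintegral_map hF (ha.measurable α)]

/-- By Tonelli the expected sum of the norms is `E|ζ| · ∑ |v α|`, which is finite. -/
theorem IsIIDStdComplexGaussian.ae_summable (ha : IsIIDStdComplexGaussian a P) {v : I → ℂ}
    (hv : Summable fun α => ‖v α‖) : ∀ᵐ ω ∂P, Summable fun α => ‖a α ω * v α‖ := by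
  have h1 : ∫⁻ ω, ∑' α, ‖a α ω * v α‖ₑ ∂P ≠ ∞ := by
    rw [lintegral_tsum fun α => (((ha.measurable α).mul_const _).enorm).aemeasurable]
    have : ∀ α, ∫⁻ ω, ‖a α ω * v α‖ₑ ∂P = (∫⁻ z, ‖z‖ₑ ∂stdComplexGaussian) * ‖v α‖ₑ := by
      intro α
      simp_rw [enorm_mul]
      rw [lintegral_mul_const _ (ha.measurable α).enorm, ha.lintegral_comp α measurable_enorm]
    simp_rw [this]
    rw [ENNReal.tsum_mul_left]
    refine ENNReal.mul_ne_top ?_ ?_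
    · have := integrable_norm_stdComplexGaussian.2
      simpa [HasFiniteIntegral] using this.ne
    · exact ENNReal.tsum_coe_ne_top_iff_summable.2 (NNReal.summable_coe.1 hv)
  filter_upwards [ae_lt_top' (AEMeasurable.tsum fun α =>
    (((ha.measurable α).mul_const _).enorm).aemeasurable) h1] with ω hω
  exact NNReal.summable_coe.2 (ENNReal.tsum_coe_ne_top_iff_summable.1 hω.ne)

omit [Countable I] in
theorem IsIIDStdComplexGaussian.integral_cexp_sum (ha : IsIIDStdComplexGaussian a P) (s : I → ℂ)
    (F : Finset I) :
    ∫ ω, Complex.exp (Complex.I * ((∑ α ∈ F, a α ω * s α).re : ℝ)) ∂P =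
      Complex.exp (-((∑ α ∈ F, ‖s α‖ ^ 2 : ℝ) / 4)) := by
  have h := (ha.indep.precomp (g := fun α : F => (α : I)) Subtype.val_injective).integral_fun_prod_comp
    (𝕜 := ℂ) (f := fun (α : F) z => Complex.exp (Complex.I * ((s α * z).re : ℝ)))
    (fun α => (ha.measurable α).aemeasurable) (fun α => by fun_prop)
  have e : ∀ α : F, ∫ ω, Complex.exp (Complex.I * ((s α * a α ω).re : ℝ)) ∂P =
      Complex.exp (-(‖s α‖ ^ 2 / 4 : ℝ)) := by
    intro α
    rw [← integral_cexp_re_mul_stdComplexGaussian, ← ha.law α,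
      integral_map (ha.measurable α).aemeasurable (by fun_prop)]
  simp only [e, ← Complex.exp_sum] at h
  rw [← Finset.sum_coe_sort F, Finset.sum_neg_distrib] at *
  convert! h using 4 with ω
  · rw [← Finset.sum_coe_sort F]
    simp only [Complex.re_sum, Complex.ofReal_sum, Finset.mul_sum, mul_comm (a _ _)]
  · push_cast
    rw [Finset.sum_div]

/-- Passes to the limit over finite partial sums: the integrands have modulus one, so dominated
convergence applies. -/
theorem IsIIDStdComplexGaussian.integral_cexp_tsum [IsProbabilityMeasure P]
    (ha : IsIIDStdComplexGaussian a P) {s : I → ℂ}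
    (hs : Summable fun α => ‖s α‖) :
    ∫ ω, Complex.exp (Complex.I * ((∑' α, a α ω * s α).re : ℝ)) ∂P =
      Complex.exp (-((∑' α, ‖s α‖ ^ 2 : ℝ) / 4)) := by
  have h2 : Summable fun α => ‖s α‖ ^ 2 := by
    have := (hs.mul_norm hs).comp_injective (i := fun α => (α, α))
      (fun _ _ h => (Prod.ext_iff.1 h).1)
    refine this.congr fun α => ?_
    simp [sq]
  have h1 : Tendsto (fun F : Finset I =>
      ∫ ω, Complex.exp (Complex.I * ((∑ α ∈ F, a α ω * s α).re : ℝ)) ∂P) atTop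
      (𝓝 (∫ ω, Complex.exp (Complex.I * ((∑' α, a α ω * s α).re : ℝ)) ∂P)) := by
    refine tendsto_integral_filter_of_dominated_convergence (fun _ => 1) ?_ ?_
      (integrable_const _) ?_
    · refine Eventually.of_forall fun F => Measurable.aestronglyMeasurable ?_
      have := ha.measurable
      fun_prop
    · refine Eventually.of_forall fun F => ae_of_all _ fun ω => ?_
      rw [mul_comm, Complex.norm_exp_ofReal_mul_I]
    · filter_upwards [ha.ae_summable hs] with ω hω
      have := hω.of_norm.hasSum
      exact ((by fun_prop : Continuous fun z : ℂ =>
        Complex.exp (Complex.I * (z.re : ℝ))).tendsto _).comp this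
  refine tendsto_nhds_unique h1 ?_
  simp_rw [ha.integral_cexp_sum]
  exact ((by fun_prop : Continuous fun x : ℝ => Complex.exp (-((x : ℂ) / 4))).tendsto _).comp
    h2.hasSum

omit [Countable I] in
theorem summable_mul_conj {u v : I → ℂ} (hu : Summable fun α => ‖u α‖)
    (hv : Summable fun α => ‖v α‖) : Summable fun α => u α * conj (v α) := by
  have := (hu.mul_norm (g := fun α => conj (v α)) (by simpa using hv)).of_norm.comp_injective
    (i := fun α => (α, α)) (fun _ _ h => (Prod.ext_iff.1 h).1)
  exact this

variable {ι : Type*} [Fintype ι]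

omit [Countable I] in
theorem tsum_finset_sum_comm {g : ι → I → ℂ} (hg : ∀ k, Summable (g k)) :
    ∑' α, ∑ k, g k α = ∑ k, ∑' α, g k α :=
  Summable.tsum_finsetSum fun k _ => hg k

/-- A linear combination of the series is one series with coefficients `∑ k, v α k * s k`. Expanding
its squared `ℓ²` norm leaves only Gram entries, so the characteristic function sees nothing else. -/
theorem IsIIDStdComplexGaussian.integral_cexp_pairing [IsProbabilityMeasure P]
    (ha : IsIIDStdComplexGaussian a P) {v : I → ι → ℂ}
    (hv : ∀ k, Summable fun α => ‖v α k‖) (s : ι → ℂ) :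
    ∫ ω, Complex.exp (Complex.I * ((∑ k, (∑' α, a α ω * v α k) * s k).re : ℝ)) ∂P =
      Complex.exp (-((∑ k, ∑ l, s k * conj (s l) * ∑' α, v α k * conj (v α l)) / 4)) := by
  have hsum : Summable fun α => ‖∑ k, v α k * s k‖ := by
    refine Summable.of_nonneg_of_le (fun _ => norm_nonneg _) (fun α => norm_sum_le _ _) ?_
    refine summable_sum fun k _ => ?_
    simp_rw [norm_mul]
    exact (hv k).mul_right _
  have h := ha.integral_cexp_tsum hsum
  have e1 : ∫ ω, Complex.exp (Complex.I * ((∑ k, (∑' α, a α ω * v α k) * s k).re : ℝ)) ∂P =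
      ∫ ω, Complex.exp (Complex.I * ((∑' α, a α ω * ∑ k, v α k * s k).re : ℝ)) ∂P := by
    refine integral_congr_ae ?_
    filter_upwards [ae_all_iff.2 fun k => ha.ae_summable (hv k)] with ω hω
    have h3 := tsum_finset_sum_comm fun k => (hω k).of_norm.mul_right (s k)
    have : ∑ k, (∑' α, a α ω * v α k) * s k = ∑' α, a α ω * ∑ k, v α k * s k := by
      simp_rw [← tsum_mul_right, ← h3, Finset.mul_sum, mul_assoc]
    rw [this]
  rw [e1, h, Complex.ofReal_tsum]
  congr 3
  have e2 : ∀ α, ((‖∑ k, v α k * s k‖ ^ 2 : ℝ) : ℂ) =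
      ∑ k, ∑ l, s k * conj (s l) * (v α k * conj (v α l)) := by
    intro α
    rw [← Complex.normSq_eq_norm_sq, ← Complex.mul_conj, map_sum, Finset.sum_mul_sum]
    refine Finset.sum_congr rfl fun k _ => Finset.sum_congr rfl fun l _ => ?_
    simp only [map_mul]; ring
  have hs2 : ∀ k l, Summable fun α => s k * conj (s l) * (v α k * conj (v α l)) :=
    fun k l => (summable_mul_conj (hv k) (hv l)).mul_left _
  simp_rw [e2]
  rw [tsum_finset_sum_comm fun k => summable_sum fun l _ => hs2 k l]
  refine Finset.sum_congr rfl fun k _ => ?_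
  rw [tsum_finset_sum_comm (hs2 k)]
  exact Finset.sum_congr rfl fun l _ => tsum_mul_left

omit [Fintype ι] in
theorem IsIIDStdComplexGaussian.measurable_tsum (ha : IsIIDStdComplexGaussian a P)
    (v : I → ι → ℂ) : Measurable fun ω k => ∑' α, a α ω * v α k :=
  measurable_pi_lambda _ fun _ => Measurable.tsum fun α => (ha.measurable α).mul_const _

/-- The joint law of finitely many absolutely convergent linear combinations of independent
standard complex Gaussian variables is determined by their Gram matrix. -/
theorem map_eq_map_of_gram_eq {J Ω' : Type*} [Countable J] [MeasurableSpace Ω'] {P' : Measure Ω'}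
    [IsProbabilityMeasure P] [IsProbabilityMeasure P'] {b : J → Ω' → ℂ}
    (ha : IsIIDStdComplexGaussian a P) (hb : IsIIDStdComplexGaussian b P')
    {v : I → ι → ℂ} {u : J → ι → ℂ} (hv : ∀ k, Summable fun α => ‖v α k‖)
    (hu : ∀ k, Summable fun β => ‖u β k‖)
    (hG : ∀ k l, ∑' α, v α k * conj (v α l) = ∑' β, u β k * conj (u β l)) :
    P.map (fun ω k => ∑' α, a α ω * v α k) = P'.map (fun ω k => ∑' β, b β ω * u β k) := by
  classical
  have m1 := ha.measurable_tsum v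
  have m2 := hb.measurable_tsum u
  have : IsProbabilityMeasure (P.map (fun ω k => ∑' α, a α ω * v α k)) :=
    Measure.isProbabilityMeasure_map m1.aemeasurable
  have : IsProbabilityMeasure (P'.map (fun ω k => ∑' α, b α ω * u α k)) :=
    Measure.isProbabilityMeasure_map m2.aemeasurable
  refine Measure.ext_of_charFunDual (funext fun Λ => ?_)
  -- The complex vector representing the real functional: `Λ x = Re ∑ x_k s_k`.
  let s : ι → ℂ := fun k => (Λ (Pi.single k 1) : ℂ) - Complex.I * Λ (Pi.single k Complex.I)
  have hΛ : ∀ x : ι → ℂ, Λ x = (∑ k, x k * s k).re := by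
    intro x
    have hx : x = ∑ k, ((x k).re • (Pi.single k (1 : ℂ) : ι → ℂ) +
        (x k).im • (Pi.single k Complex.I : ι → ℂ)) := by
      ext j
      simp only [Finset.sum_apply, Pi.add_apply, Pi.smul_apply, Pi.single_apply]
      rw [Finset.sum_eq_single j (by intro b _ hb; simp [hb.symm]) (by simp)]
      simp
    conv_lhs => rw [hx]
    simp only [map_sum, map_add, map_smul, Complex.re_sum, s]
    refine Finset.sum_congr rfl fun k _ => ?_
    simp
  rw [charFunDual_apply, charFunDual_apply, integral_map m1.aemeasurable (by fun_prop),
    integral_map m2.aemeasurable (by fun_prop)]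
  simp_rw [mul_comm _ Complex.I, hΛ]
  rw [ha.integral_cexp_pairing hv, hb.integral_cexp_pairing hu]
  simp_rw [hG]

end Law

/-! ### Nearly orthonormal Gaussian vectors. -/

section Gram

variable {ι : Type*} [Fintype ι] [DecidableEq ι]

open scoped Matrix ComplexOrder in
/-- A Hermitian matrix with unit diagonal and off-diagonal row sums at most `1/2` dominates half
of the identity. -/
theorem posSemidef_sub_half {G : Matrix ι ι ℂ} (hG : G.IsHermitian) (hd : ∀ k, G k k = 1)
    (hr : ∀ k, ∑ l, ‖G k l‖ ≤ 3 / 2) :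
    (G - Matrix.diagonal fun _ => (1 / 2 : ℂ)).PosSemidef := by
  have hH : (G - Matrix.diagonal fun _ => (1 / 2 : ℂ)).IsHermitian := by
    refine hG.sub (Matrix.isHermitian_diagonal_of_self_adjoint _ ?_)
    ext k
    simp
  refine Matrix.PosSemidef.of_dotProduct_mulVec_nonneg hH fun x => ?_
  rw [RCLike.nonneg_iff]
  refine ⟨?_, hH.im_star_dotProduct_mulVec_self x⟩
  have hsymm : ∀ k l, ‖G k l‖ = ‖G l k‖ := fun k l => by
    rw [← hG.apply k l, norm_star]
  -- Splits each off-diagonal term by `2|x_k||x_l| ≤ |x_k|² + |x_l|²`. The diagonal correction `3/2`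
  -- is chosen so that summation gives `∑ (3/2 - row sum)|x_k|²`, nonnegative by `hr`.
  have hterm : ∀ k l, -(‖G k l‖ / 2 * ‖x k‖ ^ 2) - ‖G l k‖ / 2 * ‖x l‖ ^ 2 +
      (if k = l then 3 / 2 * ‖x k‖ ^ 2 else 0) ≤
      (conj (x k) * ((G - Matrix.diagonal fun _ => (1 / 2 : ℂ) : Matrix ι ι ℂ) k l * x l)).re := by
    intro k l
    rw [Matrix.sub_apply]
    rcases eq_or_ne k l with rfl | hkl
    · rw [if_pos rfl, Matrix.diagonal_apply_eq, hd]
      have : conj (x k) * ((1 - 1 / 2) * x k) = ((1 / 2 * ‖x k‖ ^ 2 : ℝ) : ℂ) := by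
        rw [← Complex.normSq_eq_norm_sq, Complex.ofReal_mul, ← Complex.mul_conj]
        push_cast; ring
      rw [this, Complex.ofReal_re, norm_one]
      linarith
    · rw [if_neg hkl, Matrix.diagonal_apply_ne _ hkl, sub_zero, ← hsymm k l]
      have h1 := Complex.abs_re_le_norm (conj (x k) * (G k l * x l))
      rw [norm_mul, norm_mul, RCLike.norm_conj] at h1
      have h2 := (abs_le.1 h1).1
      have h3 : ‖x k‖ * (‖G k l‖ * ‖x l‖) ≤ ‖G k l‖ / 2 * ‖x k‖ ^ 2 + ‖G k l‖ / 2 * ‖x l‖ ^ 2 := by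
        nlinarith [mul_nonneg (norm_nonneg (G k l)) (sq_nonneg (‖x k‖ - ‖x l‖))]
      linarith
  have hsum := Finset.sum_le_sum fun k (_ : k ∈ Finset.univ) =>
    Finset.sum_le_sum fun l (_ : l ∈ Finset.univ) => hterm k l
  have e : RCLike.re (star x ⬝ᵥ (G - Matrix.diagonal fun _ => (1 / 2 : ℂ)) *ᵥ x) =
      ∑ k, ∑ l, (conj (x k) *
        ((G - Matrix.diagonal fun _ => (1 / 2 : ℂ) : Matrix ι ι ℂ) k l * x l)).re := by
    simp only [dotProduct, Matrix.mulVec, Finset.mul_sum, Pi.star_apply, map_sum]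
    rfl
  rw [e]
  refine le_trans ?_ hsum
  simp only [Finset.sum_add_distrib, Finset.sum_sub_distrib, Finset.sum_neg_distrib,
    Finset.sum_ite_eq, Finset.mem_univ, if_true]
  rw [Finset.sum_comm (f := fun k l => ‖G l k‖ / 2 * ‖x l‖ ^ 2)]
  simp only [← Finset.sum_mul, ← Finset.sum_div]
  have : ∑ k, (∑ l, ‖G k l‖) / 2 * ‖x k‖ ^ 2 ≤ ∑ k, 3 / 2 / 2 * ‖x k‖ ^ 2 :=
    Finset.sum_le_sum fun k _ => by gcongr; exact hr k
  have e2 : ∑ k, 3 / 2 * ‖x k‖ ^ 2 = 2 * ∑ k, 3 / 2 / 2 * ‖x k‖ ^ 2 := by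
    rw [Finset.mul_sum]; exact Finset.sum_congr rfl fun _ _ => by ring
  linarith

open scoped MatrixOrder Matrix.Norms.L2Operator ComplexOrder in
theorem exists_sub_half_eq_star_mul_self {G : Matrix ι ι ℂ} (hG : G.IsHermitian)
    (hd : ∀ k, G k k = 1) (hr : ∀ k, ∑ l, ‖G k l‖ ≤ 3 / 2) :
    ∃ B : Matrix ι ι ℂ, (G - Matrix.diagonal fun _ => (1 / 2 : ℂ)) = star B * B :=
  CStarAlgebra.nonneg_iff_eq_star_mul_self.mp (posSemidef_sub_half hG hd hr).nonneg

theorem iid_eval_pi {J : Type*} [Fintype J] :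
    IsIIDStdComplexGaussian (fun (j : J) (ω : J → ℂ) => ω j)
      (Measure.pi fun _ => stdComplexGaussian) where
  measurable j := measurable_pi_apply j
  law j := (measurePreserving_eval (fun _ : J => stdComplexGaussian) j).map_eq
  indep := iIndepFun_pi (X := fun _ => id) fun _ => aemeasurable_id

/-- Factoring the noise amplitude `√(1/2)` out of the norm costs at most a factor `2`. -/
theorem lintegral_max_one_inv_norm_half_le (b : ℂ) :
    ∫⁻ z, ENNReal.ofReal (max 1 ‖b + (√(1 / 2) : ℝ) * z‖⁻¹) ∂stdComplexGaussian ≤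
      2 * singConst := by
  set c : ℝ := √(1 / 2) with hc
  have hc2 : c ^ 2 = 1 / 2 := Real.sq_sqrt (by norm_num)
  have hc0 : 0 < c := Real.sqrt_pos.2 (by norm_num)
  have hc1 : 1 ≤ 2 * c := by nlinarith
  have hcC : (c : ℂ) ≠ 0 := by exact_mod_cast hc0.ne'
  refine (lintegral_mono (g := fun z => 2 * ENNReal.ofReal (max 1 ‖b / c + z‖⁻¹)) fun z => ?_).trans ?_
  · change _ ≤ 2 * ENNReal.ofReal _
    rw [← ENNReal.ofReal_ofNat, ← ENNReal.ofReal_mul (by simp)]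
    refine ENNReal.ofReal_le_ofReal ?_
    have h1 : b + c * z = c * (b / c + z) := by field_simp
    have h2 : 1 ≤ max 1 ‖b / c + z‖⁻¹ := le_max_left _ _
    have h3 : ‖b / c + z‖⁻¹ ≤ max 1 ‖b / c + z‖⁻¹ := le_max_right _ _
    rw [h1, norm_mul, mul_inv, Complex.norm_real, Real.norm_of_nonneg hc0.le]
    refine max_le (by linarith) ?_
    have h4 : c⁻¹ ≤ 2 := by rw [inv_le_iff_one_le_mul₀ hc0]; linarith
    exact mul_le_mul h4 h3 (by positivity) (by norm_num)
  · rw [lintegral_const_mul _ (by fun_prop)]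
    gcongr
    exact lintegral_max_one_inv_norm_le _

variable {I Ω : Type*} [Countable I] [MeasurableSpace Ω] {P : Measure Ω} [IsProbabilityMeasure P]
  {a : I → Ω → ℂ}

/-- The Gram matrix is `B*B` plus half the identity, so the vector has the law of a `B`-dependent
Gaussian vector plus independent noise `√(1/2) y`. With the first summand fixed the coordinates are
independent, and each factor is bounded whatever its shift. -/
theorem IsIIDStdComplexGaussian.lintegral_prod_max_one_inv_norm_le
    (ha : IsIIDStdComplexGaussian a P) {v : I → ι → ℂ} (hv : ∀ k, Summable fun α => ‖v α k‖)
    (hd : ∀ k, ∑' α, v α k * conj (v α k) = 1)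
    (hr : ∀ k, ∑ l, ‖∑' α, v α k * conj (v α l)‖ ≤ 3 / 2) :
    ∫⁻ ω, ∏ k, ENNReal.ofReal (max 1 ‖∑' α, a α ω * v α k‖⁻¹) ∂P ≤
      (2 * singConst) ^ Fintype.card ι := by
  let G : Matrix ι ι ℂ := Matrix.of fun k l => ∑' α, v α k * conj (v α l)
  have hG : G.IsHermitian := by
    ext k l
    simp only [Matrix.conjTranspose_apply, G, Matrix.of_apply]
    rw [← starRingEnd_apply, Complex.conj_tsum (L := .unconditional I)]
    simp [mul_comm]
  obtain ⟨B, hB⟩ := exists_sub_half_eq_star_mul_self hG hd hr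
  let c : ℝ := √(1 / 2)
  -- Conjugated so that `∑ m, w m k * conj (w m l)` is the `(k, l)` entry of `star B * B`.
  let w : ι → ι → ℂ := fun m k => conj (B m k)
  let u : ι ⊕ ι → ι → ℂ := Sum.elim w fun m k => if m = k then (c : ℂ) else 0
  have hu : ∀ k l, ∑' α, v α k * conj (v α l) = ∑' β, u β k * conj (u β l) := by
    intro k l
    have h1 : G k l - (Matrix.diagonal fun _ => (1 / 2 : ℂ)) k l = (star B * B) k l := by
      rw [← hB]; rfl
    rw [Matrix.mul_apply] at h1
    have h2 : (c : ℂ) * c = 1 / 2 := by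
      rw [← Complex.ofReal_mul, Real.mul_self_sqrt (by norm_num)]; norm_num
    change G k l = ∑' β, u β k * conj (u β l)
    rw [tsum_fintype, Fintype.sum_sum_type, sub_eq_iff_eq_add.1 h1]
    simp only [u, w, Sum.elim_inl, Sum.elim_inr, Complex.conj_conj, Matrix.star_apply]
    congr 1
    rcases eq_or_ne k l with rfl | hkl
    · rw [Matrix.diagonal_apply_eq, Finset.sum_eq_single k (by intro b _ hb; simp [hb]) (by simp)]
      simp [h2]
    · rw [Matrix.diagonal_apply_ne _ hkl, Finset.sum_eq_zero]
      intro m _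
      by_cases hm : m = k
      · subst hm; simp [hkl]
      · simp [hm]
  have key := map_eq_map_of_gram_eq ha (iid_eval_pi (J := ι ⊕ ι)) hv
    (fun k => (Summable.of_finite : Summable fun β => ‖u β k‖)) hu
  let F : (ι → ℂ) → ℝ≥0∞ := fun x => ∏ k, ENNReal.ofReal (max 1 ‖x k‖⁻¹)
  have hF : Measurable F := by
    refine Finset.measurable_prod _ fun k _ => ?_
    fun_prop
  have m1 := ha.measurable_tsum v
  have m2 := (iid_eval_pi (J := ι ⊕ ι)).measurable_tsum u
  calc ∫⁻ ω, F (fun k => ∑' α, a α ω * v α k) ∂P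
      = ∫⁻ ω, F (fun k => ∑' β, ω β * u β k) ∂(Measure.pi fun _ : ι ⊕ ι => stdComplexGaussian) := by
        rw [← lintegral_map hF m1, key, lintegral_map hF m2]
    _ = ∫⁻ p : (ι → ℂ) × (ι → ℂ), F (fun k => (∑ m, p.1 m * w m k) + c * p.2 k)
          ∂((Measure.pi fun _ => stdComplexGaussian).prod
            (Measure.pi fun _ => stdComplexGaussian)) := by
        refine ((measurePreserving_sumPiEquivProdPi_symm
          fun _ : ι ⊕ ι => stdComplexGaussian).lintegral_comp (hF.comp m2)).symm.trans ?_
        refine lintegral_congr fun p => ?_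
        refine congrArg F (funext fun k => ?_)
        beta_reduce
        rw [tsum_fintype, Fintype.sum_sum_type]
        simp [u, MeasurableEquiv.coe_sumPiEquivProdPi_symm, Equiv.sumPiEquivProdPi, mul_comm]
    _ = ∫⁻ x : ι → ℂ, ∫⁻ y : ι → ℂ, F (fun k => (∑ m, x m * w m k) + c * y k)
          ∂(Measure.pi fun _ => stdComplexGaussian) ∂(Measure.pi fun _ => stdComplexGaussian) := by
        refine lintegral_prod _ (hF.comp ?_).aemeasurable
        fun_prop
    _ ≤ ∫⁻ x : ι → ℂ, (2 * singConst) ^ Fintype.card ι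
          ∂(Measure.pi fun _ => stdComplexGaussian) := by
        refine lintegral_mono fun x => ?_
        have hm : ∀ k, Measurable fun z : ℂ =>
            ENNReal.ofReal (max 1 ‖(∑ m, x m * w m k) + c * z‖⁻¹) := fun k => by fun_prop
        have h := lintegral_prod_eq_prod_lintegral_of_indepFun Finset.univ _
          (iIndepFun_pi (μ := fun _ : ι => stdComplexGaussian)
          (X := fun k (z : ℂ) => ENNReal.ofReal (max 1 ‖(∑ m, x m * w m k) + c * z‖⁻¹))
          fun k => (hm k).aemeasurable) fun k => (hm k).comp (measurable_pi_apply k)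
        refine h.trans_le ?_
        rw [← Finset.card_univ, ← Finset.prod_const]
        refine Finset.prod_le_prod' fun k _ => ?_
        have h2 := (measurePreserving_eval (fun _ : ι => stdComplexGaussian) k).lintegral_comp (hm k)
        exact h2.trans_le (lintegral_max_one_inv_norm_half_le _)
    _ = (2 * singConst) ^ Fintype.card ι := by simp

end Gram

/-! ### The normalized field and its one-point law. -/

/-- The normalized hyperbolic GAF, whose values are standard complex Gaussian variables. -/
def normGAF {n : ℕ} (L : Fin n → ℝ) (a : (Fin n → ℕ) → ℂ) (z : Fin n → ℂ) : ℂ :=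
  ∑' α, a α * normCoeff L α z

section Field

variable {n : ℕ} {L : Fin n → ℝ}

theorem normGAF_eq (a : (Fin n → ℕ) → ℂ) (z : Fin n → ℂ) :
    normGAF L a z = hyperbolicGAF L a z * (normFactor L z : ℝ) := by
  rw [normGAF, hyperbolicGAF, ← tsum_mul_right]
  simp_rw [normCoeff, mul_assoc]

theorem measurable_normFactor : Measurable (normFactor L) := by
  unfold normFactor
  fun_prop

theorem measurable_normCoeff (α : Fin n → ℕ) : Measurable (normCoeff L α) := by
  unfold normCoeff
  have := measurable_normFactor (L := L)
  fun_prop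

variable {Ω : Type*} [MeasurableSpace Ω] {P : Measure Ω} {a : (Fin n → ℕ) → Ω → ℂ}

theorem measurable_normGAF (ha : ∀ α, Measurable (a α)) :
    Measurable fun p : (Fin n → ℂ) × Ω => normGAF L (fun α => a α p.2) p.1 := by
  refine Measurable.tsum fun α => ?_
  have := measurable_normCoeff (L := L) α
  have := ha α
  fun_prop

theorem map_normGAF [IsProbabilityMeasure P] (hL : ∀ j, 0 < L j)
    (ha : IsIIDStdComplexGaussian a P) {z : Fin n → ℂ} (hz : z ∈ polydisk n) :
    P.map (fun ω => normGAF L (fun α => a α ω) z) = stdComplexGaussian := by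
  have h := map_eq_map_of_gram_eq ha (iid_eval_pi (J := Unit))
    (v := fun α (_ : Unit) => normCoeff L α z) (u := fun _ _ => 1)
    (fun _ => summable_norm_normCoeff hL hz) (fun _ => Summable.of_finite)
    (fun _ _ => by rw [(hasSum_normCoeff_mul_conj hL hz hz).tsum_eq, normKernel_self hz]; simp)
  have h2 := congrArg (fun μ => Measure.map (fun x : Unit → ℂ => x ()) μ) h
  beta_reduce at h2
  rw [Measure.map_map (by fun_prop) (ha.measurable_tsum _),
    Measure.map_map (by fun_prop) ((iid_eval_pi (J := Unit)).measurable_tsum _)] at h2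
  refine h2.trans (Eq.trans ?_ ((iid_eval_pi (J := Unit)).law ()))
  congr 1
  ext ω
  simp

theorem lintegral_comp_normGAF [IsProbabilityMeasure P] (hL : ∀ j, 0 < L j)
    (ha : IsIIDStdComplexGaussian a P) {z : Fin n → ℂ} (hz : z ∈ polydisk n)
    {F : ℂ → ℝ≥0∞} (hF : Measurable F) :
    ∫⁻ ω, F (normGAF L (fun α => a α ω) z) ∂P = ∫⁻ w, F w ∂stdComplexGaussian := by
  rw [← map_normGAF hL ha hz, lintegral_map hF]
  exact (measurable_normGAF ha.measurable).comp (measurable_const.prodMk measurable_id)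

end Field

/-! ### Exponential tail bounds for averages. -/

/-- Exponential Chebyshev inequality for an average, by Jensen's inequality. -/
theorem measure_le_lintegral_le_exp {T Ω : Type*} [MeasurableSpace T] [MeasurableSpace Ω]
    {μ : Measure T} [IsProbabilityMeasure μ] {P : Measure Ω} [SFinite P] {G : T × Ω → ℝ}
    (hG : Measurable G) (hG0 : ∀ p, 0 ≤ G p) {B : ℝ≥0∞}
    (hB : ∀ᵐ t ∂μ, ∫⁻ ω, ENNReal.ofReal (Real.exp (G (t, ω))) ∂P ≤ B) {x : ℝ} (hx : 0 ≤ x) :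
    P {ω | ENNReal.ofReal x ≤ ∫⁻ t, ENNReal.ofReal (G (t, ω)) ∂μ} ≤
      ENNReal.ofReal (Real.exp (-x)) * B := by
  have key : ∀ ω, ENNReal.ofReal x ≤ ∫⁻ t, ENNReal.ofReal (G (t, ω)) ∂μ →
      ENNReal.ofReal (Real.exp x) ≤ ∫⁻ t, ENNReal.ofReal (Real.exp (G (t, ω))) ∂μ := by
    intro ω hω
    have hm : Measurable fun t => G (t, ω) := hG.comp (measurable_id.prodMk measurable_const)
    -- The tangent line to `exp` at `x`, rearranged without subtraction so that it can be integrated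
    -- in `ℝ≥0∞`.
    have h1 : ∀ t, ENNReal.ofReal (Real.exp x) * (1 + ENNReal.ofReal (G (t, ω))) ≤
        ENNReal.ofReal (Real.exp (G (t, ω))) + ENNReal.ofReal (Real.exp x * x) := by
      intro t
      have hg := hG0 (t, ω)
      rw [← ENNReal.ofReal_one, ← ENNReal.ofReal_add (by simp) hg,
        ← ENNReal.ofReal_mul (by positivity), ← ENNReal.ofReal_add (by positivity) (by positivity)]
      refine ENNReal.ofReal_le_ofReal ?_
      have h2 := Real.add_one_le_exp (G (t, ω) - x)
      rw [Real.exp_sub, le_div_iff₀ (Real.exp_pos x)] at h2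
      linarith
    have h3 := lintegral_mono (μ := μ) h1
    rw [lintegral_const_mul _ (by fun_prop), lintegral_add_left measurable_const,
      lintegral_add_left (by fun_prop), lintegral_const, lintegral_const, measure_univ, mul_one,
      mul_one] at h3
    have h4 : ENNReal.ofReal (Real.exp x) + ENNReal.ofReal (Real.exp x * x) ≤
        (∫⁻ t, ENNReal.ofReal (Real.exp (G (t, ω))) ∂μ) + ENNReal.ofReal (Real.exp x * x) := by
      refine le_trans ?_ h3
      rw [mul_add, mul_one, ENNReal.ofReal_mul (Real.exp_pos x).le]
      gcongr
    exact (ENNReal.add_le_add_iff_right ENNReal.ofReal_ne_top).1 h4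
  have hm2 : Measurable fun p : T × Ω => ENNReal.ofReal (Real.exp (G p)) := by fun_prop
  calc P {ω | ENNReal.ofReal x ≤ ∫⁻ t, ENNReal.ofReal (G (t, ω)) ∂μ}
      ≤ P {ω | ENNReal.ofReal (Real.exp x) ≤ ∫⁻ t, ENNReal.ofReal (Real.exp (G (t, ω))) ∂μ} :=
        measure_mono fun ω hω => key ω hω
    _ ≤ (∫⁻ ω, ∫⁻ t, ENNReal.ofReal (Real.exp (G (t, ω))) ∂μ ∂P) / ENNReal.ofReal (Real.exp x) :=
        meas_ge_le_lintegral_div hm2.lintegral_prod_left'.aemeasurable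
          (by simp [Real.exp_pos]) ENNReal.ofReal_ne_top
    _ ≤ B / ENNReal.ofReal (Real.exp x) := by
        gcongr
        rw [lintegral_lintegral_swap (f := fun ω t => ENNReal.ofReal (Real.exp (G (t, ω))))
          (hm2.comp measurable_swap).aemeasurable]
        exact (lintegral_mono_ae hB).trans (by simp)
    _ = ENNReal.ofReal (Real.exp (-x)) * B := by
        rw [Real.exp_neg, ENNReal.ofReal_inv_of_pos (Real.exp_pos x), mul_comm]
        rfl

theorem polydisk_eq_ball (n : ℕ) : polydisk n = Metric.ball 0 1 := by
  ext z
  simp [polydisk, pi_norm_lt_iff]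

theorem measurableSet_polydisk (n : ℕ) : MeasurableSet (polydisk n) := by
  rw [polydisk_eq_ball]; exact Metric.isOpen_ball.measurableSet

theorem volume_polydisk_pos (n : ℕ) : 0 < volume (polydisk n) := by
  rw [polydisk_eq_ball]; exact Metric.measure_ball_pos _ _ one_pos

theorem volume_polydisk_ne_top (n : ℕ) : volume (polydisk n) ≠ ∞ := by
  rw [polydisk_eq_ball]; exact measure_ball_lt_top.ne

/-- Normalized restriction of Lebesgue measure. -/
def uniformOn {n : ℕ} (s : Set (Fin n → ℂ)) : Measure (Fin n → ℂ) :=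
  (volume s)⁻¹ • volume.restrict s

theorem isProbabilityMeasure_uniformOn {n : ℕ} {s : Set (Fin n → ℂ)} (h0 : volume s ≠ 0)
    (h1 : volume s ≠ ∞) : IsProbabilityMeasure (uniformOn s) :=
  ⟨by simp [uniformOn, ENNReal.inv_mul_cancel h0 h1]⟩

/-! ### The positive part of the potential. -/

section Positive

variable {n : ℕ} {L : Fin n → ℝ}
variable {Ω : Type*} [MeasurableSpace Ω] {P : Measure Ω} {a : (Fin n → ℕ) → Ω → ℂ}

/-- Where the logarithm is positive the left side is `(|w|²)^p`, and `t^p ≤ p! e^t` at `t = |w|²/2`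
leaves a Gaussian-integrable bound. -/
theorem exp_mul_posLog_sq_le (p : ℕ) (w : ℂ) :
    Real.exp (p * max 0 (Real.log (‖w‖ ^ 2))) ≤
      1 + 2 ^ p * p.factorial * Real.exp (‖w‖ ^ 2 / 2) := by
  have h0 : 0 ≤ 2 ^ p * p.factorial * Real.exp (‖w‖ ^ 2 / 2) := by positivity
  rcases le_total (Real.log (‖w‖ ^ 2)) 0 with h | h
  · rw [max_eq_left h, mul_zero, Real.exp_zero]
    linarith
  · rw [max_eq_right h]
    rcases eq_or_ne w 0 with rfl | hw
    · simp
    have hw : 0 < ‖w‖ ^ 2 := pow_pos (norm_pos_iff.2 hw) 2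
    rw [mul_comm, Real.exp_mul, Real.exp_log hw, Real.rpow_natCast]
    have := Real.pow_div_factorial_le_exp (‖w‖ ^ 2 / 2) (by positivity) p
    rw [div_pow, div_div, div_le_iff₀ (by positivity)] at this
    linarith

/-- The exponent `p` stays free here; it is taken of order `∏ L_j` at the end. -/
theorem measure_posLog_ge_le [IsProbabilityMeasure P] (hL : ∀ j, 0 < L j)
    (ha : IsIIDStdComplexGaussian a P) {p : ℕ} {x : ℝ} (hx : 0 ≤ x) :
    P {ω | ENNReal.ofReal x ≤ ∫⁻ z in polydisk n,
      ENNReal.ofReal (max 0 (Real.log (‖normGAF L (fun α => a α ω) z‖ ^ 2)))} ≤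
      ENNReal.ofReal (Real.exp (-(p * x / (volume (polydisk n)).toReal)) *
        (1 + 2 * (2 ^ p * p.factorial))) := by
  have hV0 := (volume_polydisk_pos n).ne'
  have hV1 := volume_polydisk_ne_top n
  have hV : 0 < (volume (polydisk n)).toReal := ENNReal.toReal_pos hV0 hV1
  have := isProbabilityMeasure_uniformOn hV0 hV1
  have hm : Measurable fun q : (Fin n → ℂ) × Ω =>
      max 0 (Real.log (‖normGAF L (fun α => a α q.2) q.1‖ ^ 2)) := by
    have := measurable_normGAF (L := L) ha.measurable
    fun_prop
  have h := measure_le_lintegral_le_exp (μ := uniformOn (polydisk n)) (P := P)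
    (G := fun q => p * max 0 (Real.log (‖normGAF L (fun α => a α q.2) q.1‖ ^ 2)))
    (B := ENNReal.ofReal (1 + 2 * (2 ^ p * p.factorial)))
    (by fun_prop) (fun q => by positivity) ?_ (x := p * x / (volume (polydisk n)).toReal)
    (by positivity)
  · rw [ENNReal.ofReal_mul (Real.exp_pos _).le]
    refine le_trans (measure_mono fun ω hω => ?_) h
    simp only [Set.mem_ofPred_eq] at hω ⊢
    simp only [ENNReal.ofReal_mul (Nat.cast_nonneg p), uniformOn, lintegral_smul_measure]
    rw [lintegral_const_mul _ (by
      exact (hm.comp (measurable_id.prodMk measurable_const)).ennreal_ofReal), mul_div_assoc,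
      ENNReal.ofReal_mul (Nat.cast_nonneg p), ENNReal.ofReal_div_of_pos hV,
      ENNReal.ofReal_toReal hV1, smul_eq_mul, ← mul_assoc, mul_comm _ (ENNReal.ofReal (p : ℝ)),
      mul_assoc, ENNReal.div_eq_inv_mul]
    gcongr
  · have hae : ∀ᵐ z ∂(uniformOn (polydisk n)), z ∈ polydisk n :=
      Measure.ae_smul_measure (ae_restrict_mem (measurableSet_polydisk n)) _
    filter_upwards [hae] with z hz
    rw [lintegral_comp_normGAF hL ha hz
      (F := fun w => ENNReal.ofReal (Real.exp (p * max 0 (Real.log (‖w‖ ^ 2))))) (by fun_prop)]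
    refine (lintegral_mono fun w => ENNReal.ofReal_le_ofReal (exp_mul_posLog_sq_le p w)).trans ?_
    have e : ∀ w : ℂ, ENNReal.ofReal (1 + 2 ^ p * p.factorial * Real.exp (‖w‖ ^ 2 / 2)) =
        1 + ENNReal.ofReal (2 ^ p * p.factorial) * ENNReal.ofReal (Real.exp (‖w‖ ^ 2 / 2)) := by
      intro w
      rw [← ENNReal.ofReal_mul (by positivity), ← ENNReal.ofReal_one,
        ← ENNReal.ofReal_add (by simp) (by positivity)]
    simp_rw [e]
    rw [lintegral_add_left measurable_const, lintegral_const_mul _ (by fun_prop),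
      lintegral_exp_half_norm_sq, lintegral_const, measure_univ, mul_one,
      ENNReal.ofReal_add (by simp) (by positivity), ENNReal.ofReal_one,
      ENNReal.ofReal_mul (by simp), mul_comm]
    simp

end Positive

/-! ### Lattices adapted to the correlation length. -/

section Lattice

theorem sum_pow_natAbs_le {q : ℝ} (h0 : 0 ≤ q) (h1 : q < 1) (s : Finset ℤ) (k : ℤ) :
    ∑ l ∈ s, q ^ (k - l).natAbs ≤ (1 + q) / (1 - q) := by
  have hg := hasSum_geometric_of_lt_one h0 h1
  have hs : HasSum (fun m : ℤ => q ^ m.natAbs) ((1 - q)⁻¹ + q * (1 - q)⁻¹) := by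
    refine HasSum.of_nat_of_neg_add_one (by simpa using hg) ?_
    refine (hg.mul_left q).congr_fun fun m => ?_
    have : (-((m : ℤ) + 1)).natAbs = m + 1 := by omega
    rw [this, pow_succ']
  have h2 := (Equiv.subLeft k).hasSum_iff.2 hs
  have h3 := sum_le_hasSum s (fun l _ => by simp only [Function.comp_apply]; positivity) h2
  refine h3.trans (le_of_eq ?_)
  rw [div_eq_mul_inv]; ring

/-- The spacing of a lattice, in units of the correlation length, at which the values of the
normalized GAF are nearly independent. -/
theorem exists_lattice_spacing (n : ℕ) : ∃ M : ℝ, 0 < M ∧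
    ∀ (s : Fin n → Finset ℤ) (k : Fin n → ℤ × ℤ),
      ∑ l ∈ Fintype.piFinset fun j => s j ×ˢ s j, ∏ j, Real.exp (-(M ^ 2 *
        ((((k j).1 - (l j).1 : ℤ) : ℝ) ^ 2 + (((k j).2 - (l j).2 : ℤ) : ℝ) ^ 2) / 8)) ≤ 3 / 2 := by
  obtain ⟨q, hq, hq0, hq1⟩ : ∃ q : ℝ, (((1 + q) / (1 - q)) ^ 2) ^ n ≤ 3 / 2 ∧ 0 < q ∧ q < 1 := by
    -- The bound on the row sums tends to `1` as `q → 0`, so a small `q` brings it below `3/2`.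
    have hc : ContinuousAt (fun q : ℝ => (((1 + q) / (1 - q)) ^ 2) ^ n) 0 := by
      have : ContinuousAt (fun q : ℝ => (1 + q) / (1 - q)) 0 :=
        ContinuousAt.div (by fun_prop) (by fun_prop) (by norm_num)
      fun_prop
    have h1 : ∀ᶠ q in 𝓝 (0 : ℝ), (((1 + q) / (1 - q)) ^ 2) ^ n ≤ 3 / 2 := by
      refine hc.eventually_le_const ?_
      norm_num
    have h2 : ∀ᶠ q in 𝓝[>] (0 : ℝ), (((1 + q) / (1 - q)) ^ 2) ^ n ≤ 3 / 2 ∧ 0 < q ∧ q < 1 :=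
      (h1.filter_mono nhdsWithin_le_nhds).and (Ioo_mem_nhdsGT one_pos)
    exact h2.exists
  have hlog : 0 < -Real.log q := neg_pos.2 (Real.log_neg hq0 hq1)
  -- This `M` makes `exp(-M² d² / 8) = q^{d²} ≤ q^{|d|}` for integers `d`. The lattice sum then
  -- factors into `2n` geometric sums.
  refine ⟨√(8 * -Real.log q), Real.sqrt_pos.2 (by positivity), fun s k => ?_⟩
  have hterm : ∀ d : ℤ, Real.exp (-(√(8 * -Real.log q) ^ 2 * (d : ℝ) ^ 2 / 8)) ≤ q ^ d.natAbs := by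
    intro d
    rw [Real.sq_sqrt (by positivity), ← Real.exp_log (pow_pos hq0 _), Real.log_pow]
    refine Real.exp_le_exp.2 ?_
    have : (d.natAbs : ℝ) ≤ (d : ℝ) ^ 2 := by
      have h : ((d.natAbs : ℤ)) ≤ d ^ 2 := Int.natAbs_le_self_sq d
      have h2 : ((d.natAbs : ℤ) : ℝ) ≤ ((d ^ 2 : ℤ) : ℝ) := Int.cast_le.2 h
      rw [Int.cast_natCast] at h2
      push_cast at h2
      exact h2
    nlinarith
  rw [← Finset.prod_univ_sum (fun j => s j ×ˢ s j) (fun j p => Real.exp (-(√(8 * -Real.log q) ^ 2 *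
        ((((k j).1 - p.1 : ℤ) : ℝ) ^ 2 + (((k j).2 - p.2 : ℤ) : ℝ) ^ 2) / 8)))]
  refine le_trans ?_ hq
  have hcard : (((1 + q) / (1 - q)) ^ 2) ^ n = ∏ _j : Fin n, ((1 + q) / (1 - q)) ^ 2 := by simp
  rw [hcard]
  refine Finset.prod_le_prod (fun j _ => Finset.sum_nonneg fun _ _ => (Real.exp_pos _).le)
    fun j _ => ?_
  calc _ ≤ ∑ p ∈ s j ×ˢ s j, q ^ ((k j).1 - p.1).natAbs * q ^ ((k j).2 - p.2).natAbs := by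
        refine Finset.sum_le_sum fun p _ => ?_
        rw [mul_add, add_div, neg_add, Real.exp_add]
        exact mul_le_mul (hterm _) (hterm _) (Real.exp_pos _).le (by positivity)
    _ = (∑ l ∈ s j, q ^ ((k j).1 - l).natAbs) * ∑ l ∈ s j, q ^ ((k j).2 - l).natAbs := by
        rw [Finset.sum_mul_sum, Finset.sum_product]
    _ ≤ ((1 + q) / (1 - q)) ^ 2 := by
        rw [sq]
        exact mul_le_mul (sum_pow_natAbs_le hq0.le hq1 _ _) (sum_pow_natAbs_le hq0.le hq1 _ _)
          (Finset.sum_nonneg fun _ _ => by positivity)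
          (div_nonneg (by linarith) (by linarith))

/-- The closed cell `[0, h_j]²` in each coordinate. -/
def cell {n : ℕ} (h : Fin n → ℝ) : Set (Fin n → ℂ) :=
  Set.univ.pi fun j => Set.Icc 0 (h j) ×ℂ Set.Icc 0 (h j)

theorem measurableSet_cell {n : ℕ} (h : Fin n → ℝ) : MeasurableSet (cell h) :=
  MeasurableSet.univ_pi fun _ =>
    (measurableSet_Icc.preimage Complex.measurable_re).inter
      (measurableSet_Icc.preimage Complex.measurable_im)

theorem volume_cell {n : ℕ} {h : Fin n → ℝ} (hh : ∀ j, 0 ≤ h j) :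
    volume (cell h) = ENNReal.ofReal (∏ j, h j ^ 2) := by
  rw [cell, volume_pi_pi, ENNReal.ofReal_prod_of_nonneg fun j _ => by positivity]
  refine Finset.prod_congr rfl fun j _ => ?_
  have : Set.Icc 0 (h j) ×ℂ Set.Icc 0 (h j) =
      Complex.measurableEquivRealProd ⁻¹' (Set.Icc 0 (h j) ×ˢ Set.Icc 0 (h j)) := by
    ext z; simp [Complex.mem_reProdIm]; tauto
  rw [this, Complex.volume_preserving_equiv_real_prod.measure_preimage
    (measurableSet_Icc.prod measurableSet_Icc).nullMeasurableSet, Measure.volume_eq_prod,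
    Measure.prod_prod, Real.volume_Icc, sub_zero, ← ENNReal.ofReal_mul (hh j), sq]

/-- The lattice points with spacing `h_j` in the `j`-th coordinate. -/
def latticePoint {n : ℕ} (h : Fin n → ℝ) (k : Fin n → ℤ × ℤ) (j : Fin n) : ℂ :=
  h j * ((k j).1 + (k j).2 * Complex.I)

/-- Indices of lattice cells covering the polydisk. -/
def latticeIndices {n : ℕ} (h : Fin n → ℝ) : Finset (Fin n → ℤ × ℤ) :=
  Fintype.piFinset fun j =>
    Finset.Icc (-⌈(h j)⁻¹⌉) ⌈(h j)⁻¹⌉ ×ˢ Finset.Icc (-⌈(h j)⁻¹⌉) ⌈(h j)⁻¹⌉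

theorem floor_div_mem_Icc {h x : ℝ} (hh : 0 < h) (hx : |x| ≤ 1) :
    ⌊x / h⌋ ∈ Finset.Icc (-⌈h⁻¹⌉) ⌈h⁻¹⌉ := by
  obtain ⟨h1, h2⟩ := abs_le.1 hx
  have h3 : (0 : ℝ) < h⁻¹ := inv_pos.2 hh
  have h4 := Int.le_ceil (h⁻¹)
  rw [Finset.mem_Icc, Int.le_floor, div_eq_mul_inv]
  constructor
  · push_cast; nlinarith
  · rw [← Int.lt_add_one_iff, Int.floor_lt]
    push_cast; nlinarith

theorem sub_mul_floor_mem_Icc {h : ℝ} (hh : 0 < h) (x : ℝ) : x - h * ⌊x / h⌋ ∈ Set.Icc 0 h := by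
  have h1 := Int.floor_le (x / h)
  have h2 := Int.lt_floor_add_one (x / h)
  rw [le_div_iff₀ hh] at h1
  rw [div_lt_iff₀ hh] at h2
  constructor <;> nlinarith

theorem exists_sub_latticePoint_mem_cell {n : ℕ} {h : Fin n → ℝ} (hh : ∀ j, 0 < h j)
    {z : Fin n → ℂ} (hz : z ∈ polydisk n) :
    ∃ k ∈ latticeIndices h, z - latticePoint h k ∈ cell h := by
  refine ⟨fun j => (⌊(z j).re / h j⌋, ⌊(z j).im / h j⌋), ?_, ?_⟩
  · rw [latticeIndices, Fintype.mem_piFinset]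
    intro j
    rw [Finset.mem_product]
    exact ⟨floor_div_mem_Icc (hh j) ((Complex.abs_re_le_norm _).trans (hz j).le),
      floor_div_mem_Icc (hh j) ((Complex.abs_im_le_norm _).trans (hz j).le)⟩
  · intro j _
    rw [Complex.mem_reProdIm]
    have h1 := sub_mul_floor_mem_Icc (hh j) (z j).re
    have h2 := sub_mul_floor_mem_Icc (hh j) (z j).im
    simpa [latticePoint] using And.intro h1 h2

/-- Each real direction has `2⌈1/h⌉ + 1 ≤ 2/h + 3 ≤ 5/h` indices, the last step because `h ≤ 1`;
each complex coordinate has two directions. -/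
theorem card_latticeIndices_le {n : ℕ} {h : Fin n → ℝ} (hh : ∀ j, 0 < h j) (hh1 : ∀ j, h j ≤ 1) :
    ((latticeIndices h).card : ℝ) ≤ 25 ^ n / ∏ j, h j ^ 2 := by
  rw [latticeIndices, Fintype.card_piFinset]
  push_cast
  have : (25 : ℝ) ^ n / ∏ j, h j ^ 2 = ∏ j, 25 / h j ^ 2 := by simp [Finset.prod_div_distrib]
  rw [this]
  refine Finset.prod_le_prod (fun _ _ => by positivity) fun j _ => ?_
  rw [Finset.card_product, Int.card_Icc]
  have h0 : 1 ≤ (h j)⁻¹ := (one_le_inv₀ (hh j)).2 (hh1 j)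
  have h1 := Int.ceil_lt_add_one ((h j)⁻¹)
  have h2 := Int.le_ceil ((h j)⁻¹)
  have h3 : (0 : ℤ) ≤ ⌈(h j)⁻¹⌉ + 1 - -⌈(h j)⁻¹⌉ := by
    have : (0 : ℤ) ≤ ⌈(h j)⁻¹⌉ := Int.ceil_nonneg (by linarith)
    omega
  have h4 : (((⌈(h j)⁻¹⌉ + 1 - -⌈(h j)⁻¹⌉).toNat : ℤ) : ℝ) ≤ 5 * (h j)⁻¹ := by
    rw [Int.toNat_of_nonneg h3]; push_cast; linarith
  rw [Int.cast_natCast] at h4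
  push_cast
  calc _ ≤ (5 * (h j)⁻¹) * (5 * (h j)⁻¹) := mul_le_mul h4 h4 (by positivity) (by positivity)
    _ = 25 / h j ^ 2 := by rw [div_eq_mul_inv, ← inv_pow]; ring

/-- The translated cells cover the polydisk. Overlaps and translates leaving the polydisk do no
harm, since only an upper bound for a nonnegative integrand is needed. -/
theorem lintegral_polydisk_le_sum_cell {n : ℕ} {h : Fin n → ℝ} (hh : ∀ j, 0 < h j)
    {F : (Fin n → ℂ) → ℝ≥0∞} (hF : Measurable F) :
    ∫⁻ z in polydisk n, F z ≤ ∫⁻ τ in cell h,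
      ∑ k ∈ latticeIndices h, (polydisk n).indicator F (τ + latticePoint h k) := by
  have hF' : Measurable ((polydisk n).indicator F) := hF.indicator (measurableSet_polydisk n)
  have hk : ∀ k, Measurable fun τ => (polydisk n).indicator F (τ + latticePoint h k) :=
    fun k => hF'.comp (measurable_add_const _)
  rw [lintegral_finsetSum _ fun k _ => hk k,
    ← lintegral_indicator (measurableSet_polydisk n)]
  have h1 : ∀ k, ∫⁻ τ in cell h, (polydisk n).indicator F (τ + latticePoint h k) =
      ∫⁻ z, (cell h).indicator 1 (z - latticePoint h k) * (polydisk n).indicator F z := by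
    intro k
    rw [← lintegral_indicator (measurableSet_cell h), ← lintegral_add_right_eq_self
      (fun z => (cell h).indicator 1 (z - latticePoint h k) * (polydisk n).indicator F z)
      (latticePoint h k)]
    refine lintegral_congr fun τ => ?_
    rw [add_sub_cancel_right]
    by_cases hτ : τ ∈ cell h <;> simp [hτ]
  simp_rw [h1]
  have hk' : ∀ k, Measurable fun z =>
      (cell h).indicator 1 (z - latticePoint h k) * (polydisk n).indicator F z :=
    fun k => Measurable.mul ((measurable_one.indicator
      (measurableSet_cell h)).comp (measurable_sub_const _)) hF'
  rw [← lintegral_finsetSum _ fun k _ => hk' k]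
  refine lintegral_mono fun z => ?_
  by_cases hz : z ∈ polydisk n
  · obtain ⟨k, hk, hzk⟩ := exists_sub_latticePoint_mem_cell hh hz
    refine le_trans ?_ (Finset.single_le_sum (fun _ _ => zero_le) hk)
    simp [hzk]
  · simp [hz]

end Lattice

/-! ### The negative part of the potential. -/

section Negative

/-- The weight `1/2` turns the logarithm of `|w|²` into the singularity `|w|⁻¹`, which is integrable
in the plane. -/
theorem exp_half_negLog_sq_le (w : ℂ) :
    Real.exp (1 / 2 * max 0 (-Real.log (‖w‖ ^ 2))) ≤ max 1 ‖w‖⁻¹ := by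
  rcases le_total (-Real.log (‖w‖ ^ 2)) 0 with h | h
  · rw [max_eq_left h, mul_zero, Real.exp_zero]
    exact le_max_left _ _
  · rw [max_eq_right h]
    -- With the conventions `log 0 = 0` and `0⁻¹ = 0`, both sides equal `1` at the origin.
    rcases eq_or_ne w 0 with rfl | hw
    · simp
    have hw : 0 < ‖w‖ := norm_pos_iff.2 hw
    rw [Real.log_pow, show 1 / 2 * -(((2 : ℕ) : ℝ) * Real.log ‖w‖) = -Real.log ‖w‖ by push_cast; ring,
      Real.exp_neg, Real.exp_log hw]
    exact le_max_right _ _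

variable {n : ℕ} {L : Fin n → ℝ}
variable {Ω : Type*} [MeasurableSpace Ω] {P : Measure Ω} [IsProbabilityMeasure P]
  {a : (Fin n → ℕ) → Ω → ℂ}

theorem lintegral_prod_max_one_inv_normGAF_le (hL : ∀ j, 0 < L j)
    (ha : IsIIDStdComplexGaussian a P) {ι : Type*} [DecidableEq ι] (s : Finset ι)
    {z : ι → Fin n → ℂ} (hz : ∀ k ∈ s, z k ∈ polydisk n)
    (hr : ∀ k ∈ s, ∑ l ∈ s, ‖normKernel L (z k) (z l)‖ ≤ 3 / 2) :
    ∫⁻ ω, ∏ k ∈ s, ENNReal.ofReal (max 1 ‖normGAF L (fun α => a α ω) (z k)‖⁻¹) ∂P ≤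
      (2 * singConst) ^ s.card := by
  have h := ha.lintegral_prod_max_one_inv_norm_le (ι := s)
    (v := fun α (k : s) => normCoeff L α (z k))
    (fun k => summable_norm_normCoeff hL (hz k k.2))
    (fun k => by
      rw [(hasSum_normCoeff_mul_conj hL (hz k k.2) (hz k k.2)).tsum_eq,
        normKernel_self (hz k k.2)])
    (fun k => by
      have : ∀ l : s, ∑' α, normCoeff L α (z k) * conj (normCoeff L α (z l)) =
        normKernel L (z k) (z l) := fun l =>
          (hasSum_normCoeff_mul_conj hL (hz k k.2) (hz l l.2)).tsum_eq
      simp_rw [this]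
      rw [Finset.sum_coe_sort s fun l => ‖normKernel L (z k) (z l)‖]
      exact hr k k.2)
  rw [Fintype.card_coe] at h
  refine le_trans (le_of_eq ?_) h
  refine lintegral_congr fun ω => ?_
  exact (Finset.prod_coe_sort s fun k =>
    ENNReal.ofReal (max 1 ‖normGAF L (fun α => a α ω) (z k)‖⁻¹)).symm

/-- The exponential moment of the negative part of `log |f|²`, summed over a translated lattice. -/
theorem lintegral_exp_sum_negLog_le {M : ℝ} {h : Fin n → ℝ}
    (hh : ∀ j, L j * h j ^ 2 = M ^ 2)
    (hM : ∀ (s : Fin n → Finset ℤ) (k : Fin n → ℤ × ℤ),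
      ∑ l ∈ Fintype.piFinset fun j => s j ×ˢ s j, ∏ j, Real.exp (-(M ^ 2 *
        ((((k j).1 - (l j).1 : ℤ) : ℝ) ^ 2 + (((k j).2 - (l j).2 : ℤ) : ℝ) ^ 2) / 8)) ≤ 3 / 2)
    (hL : ∀ j, 0 < L j) (ha : IsIIDStdComplexGaussian a P) (τ : Fin n → ℂ) :
    ∫⁻ ω, ENNReal.ofReal (Real.exp (∑ k ∈ latticeIndices h, (polydisk n).indicator
      (fun z => 1 / 2 * max 0 (-Real.log (‖normGAF L (fun α => a α ω) z‖ ^ 2)))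
        (τ + latticePoint h k))) ∂P ≤
      (2 * singConst) ^ (latticeIndices h).card := by
  classical
  -- Only lattice points inside the polydisk carry a Gaussian value; the others contribute a factor
  -- `1`.
  set s := (latticeIndices h).filter fun k => τ + latticePoint h k ∈ polydisk n with hs
  have h1 := lintegral_prod_max_one_inv_normGAF_le hL ha s (z := fun k => τ + latticePoint h k)
    (fun k hk => (Finset.mem_filter.1 hk).2) (fun k hk => by
      refine le_trans ?_ (hM (fun j => Finset.Icc (-⌈(h j)⁻¹⌉) ⌈(h j)⁻¹⌉) k)
      refine (Finset.sum_le_sum fun l hl => norm_normKernel_le hL (Finset.mem_filter.1 hk).2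
        (Finset.mem_filter.1 hl).2).trans ?_
      refine (Finset.sum_le_sum_of_subset_of_nonneg (Finset.filter_subset _ _)
        fun _ _ _ => Finset.prod_nonneg fun _ _ => (Real.exp_pos _).le).trans (le_of_eq ?_)
      refine Finset.sum_congr rfl fun l _ => Finset.prod_congr rfl fun j _ => ?_
      have e1 : (τ + latticePoint h k) j - (τ + latticePoint h l) j =
          h j * ((((k j).1 - (l j).1 : ℤ) : ℂ) + (((k j).2 - (l j).2 : ℤ) : ℂ) * Complex.I) := by
        simp only [Pi.add_apply, latticePoint]
        push_cast; ring
      have e2 : ‖h j * ((((k j).1 - (l j).1 : ℤ) : ℂ) +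
          (((k j).2 - (l j).2 : ℤ) : ℂ) * Complex.I)‖ ^ 2 =
          h j ^ 2 * ((((k j).1 - (l j).1 : ℤ) : ℝ) ^ 2 + (((k j).2 - (l j).2 : ℤ) : ℝ) ^ 2) := by
        rw [norm_mul, mul_pow, Complex.norm_real, Real.norm_eq_abs, sq_abs,
          ← Complex.normSq_eq_norm_sq, ← Complex.normSq_add_mul_I]
        push_cast
        rfl
      rw [e1, e2, ← mul_assoc, hh])
  refine le_trans (lintegral_mono fun ω => ?_) (h1.trans ?_)
  · rw [Real.exp_sum, ENNReal.ofReal_prod_of_nonneg fun _ _ => (Real.exp_pos _).le, hs,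
      Finset.prod_filter]
    refine Finset.prod_le_prod' fun k _ => ?_
    by_cases hk : τ + latticePoint h k ∈ polydisk n
    · rw [if_pos hk, Set.indicator_of_mem hk]
      exact ENNReal.ofReal_le_ofReal (exp_half_negLog_sq_le _)
    · simp [hk]
  · exact pow_le_pow_right₀ (one_le_singConst.trans (le_mul_of_one_le_left' (by norm_num)))
      (Finset.card_le_card (Finset.filter_subset _ _))

end Negative

/-- The integral over the polydisk is at most the cell volume times the average, over translates `τ`
in a cell, of lattice sums. Each lattice sum has exponential moment `exp(O(R))`, `R = ∏ L_j`, and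
the inverse cell volume `R / M^{2n}` multiplies the level `x`, so both exponents scale with `R`. -/
theorem measure_negLog_ge_le (n : ℕ) : ∃ M : ℝ, 0 < M ∧ ∃ A : ℝ, ∀ L : Fin n → ℝ,
    (∀ j, 0 < L j) → (∀ j, M ^ 2 ≤ L j) →
    ∀ (Ω : Type*) [MeasurableSpace Ω] (P : Measure Ω) [IsProbabilityMeasure P]
      (a : (Fin n → ℕ) → Ω → ℂ), IsIIDStdComplexGaussian a P → ∀ x : ℝ, 0 ≤ x →
      P {ω | ENNReal.ofReal x ≤ ∫⁻ z in polydisk n,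
        ENNReal.ofReal (max 0 (-Real.log (‖normGAF L (fun α => a α ω) z‖ ^ 2)))} ≤
        ENNReal.ofReal (Real.exp ((A - x / 2) * ((∏ j, L j) / (M ^ 2) ^ n))) := by
  obtain ⟨M, hM0, hM⟩ := exists_lattice_spacing n
  refine ⟨M, hM0, 25 ^ n * Real.log (2 * singConst).toReal, fun L hL hLM Ω _ P _ a ha x hx => ?_⟩
  have hC : 1 ≤ (2 * singConst).toReal := by
    rw [← ENNReal.toReal_one]
    refine ENNReal.toReal_mono (ENNReal.mul_ne_top (by simp) singConst_ne_top) ?_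
    exact one_le_singConst.trans (le_mul_of_one_le_left' (by norm_num))
  have hCtop : 2 * singConst ≠ ∞ := ENNReal.mul_ne_top (by simp) singConst_ne_top
  -- Spacing proportional to the correlation length, so that `L j * h j ^ 2 = M ^ 2` for every `j`.
  let h : Fin n → ℝ := fun j => M / √(L j)
  have hpos : ∀ j, 0 < h j := fun j => div_pos hM0 (Real.sqrt_pos.2 (hL j))
  have hle : ∀ j, h j ≤ 1 := fun j => by
    rw [div_le_one (Real.sqrt_pos.2 (hL j))]
    exact Real.le_sqrt_of_sq_le (hLM j)
  have hsq : ∀ j, h j ^ 2 = M ^ 2 / L j := fun j => by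
    simp only [h]; rw [div_pow, Real.sq_sqrt (hL j).le]
  have hh : ∀ j, L j * h j ^ 2 = M ^ 2 := fun j => by
    rw [hsq]; field_simp [(hL j).ne']
  have hprod : ∏ j, h j ^ 2 = (M ^ 2) ^ n / ∏ j, L j := by
    simp_rw [hsq]; simp [Finset.prod_div_distrib]
  have hPL : 0 < ∏ j, L j := Finset.prod_pos fun j _ => hL j
  have hvpos : 0 < ∏ j, h j ^ 2 := Finset.prod_pos fun j _ => pow_pos (hpos j) 2
  set W := (∏ j, L j) / (M ^ 2) ^ n with hW
  have hWinv : W = (∏ j, h j ^ 2)⁻¹ := by rw [hprod, inv_div]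
  have hW0 : 0 < W := by rw [hWinv]; positivity
  have hvol := volume_cell fun j => (hpos j).le
  have hv0 : volume (cell h) ≠ 0 := by rw [hvol]; simpa using hvpos
  have hv1 : volume (cell h) ≠ ∞ := by rw [hvol]; simp
  have := isProbabilityMeasure_uniformOn hv0 hv1
  have hmX := measurable_normGAF (L := L) ha.measurable
  let g : (Fin n → ℂ) × Ω → ℝ := fun q => (polydisk n).indicator
      (fun z => 1 / 2 * max 0 (-Real.log (‖normGAF L (fun α => a α q.2) z‖ ^ 2))) q.1
  have hg : Measurable g := by
    have : g = (Prod.fst ⁻¹' polydisk n).indicator fun q : (Fin n → ℂ) × Ω =>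
        1 / 2 * max 0 (-Real.log (‖normGAF L (fun α => a α q.2) q.1‖ ^ 2)) := by
      ext q; simp only [g, Set.indicator]; rfl
    rw [this]
    exact Measurable.indicator (by fun_prop) (measurable_fst (measurableSet_polydisk n))
  have hg0 : ∀ q, 0 ≤ g q := fun q => Set.indicator_nonneg (fun _ _ => by positivity) _
  have key := measure_le_lintegral_le_exp (μ := uniformOn (cell h)) (P := P)
    (G := fun q => ∑ k ∈ latticeIndices h, g (q.1 + latticePoint h k, q.2))
    (B := (2 * singConst) ^ (latticeIndices h).card)
    (Finset.measurable_sum _ fun k _ => hg.comp (by fun_prop))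
    (fun q => Finset.sum_nonneg fun k _ => hg0 _)
    (ae_of_all _ fun τ => lintegral_exp_sum_negLog_le hh hM hL ha τ) (x := W * (x / 2))
    (by positivity)
  refine (measure_mono fun ω hω => ?_).trans (key.trans ?_)
  · rw [Set.mem_ofPred_eq] at hω ⊢
    let F : (Fin n → ℂ) → ℝ≥0∞ := fun z =>
      ENNReal.ofReal (max 0 (-Real.log (‖normGAF L (fun α => a α ω) z‖ ^ 2)))
    have hF : Measurable F := by
      have := hmX.comp (measurable_id.prodMk (measurable_const (a := ω)))
      have : Measurable fun z => normGAF L (fun α => a α ω) z := this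
      fun_prop
    have h1 := hω.trans (lintegral_polydisk_le_sum_cell hpos hF)
    have h2 : ∀ τ, ENNReal.ofReal (∑ k ∈ latticeIndices h, g (τ + latticePoint h k, ω)) =
        ENNReal.ofReal (1 / 2) * ∑ k ∈ latticeIndices h,
          (polydisk n).indicator F (τ + latticePoint h k) := by
      intro τ
      rw [ENNReal.ofReal_sum_of_nonneg fun k _ => hg0 _, Finset.mul_sum]
      refine Finset.sum_congr rfl fun k _ => ?_
      by_cases hk : τ + latticePoint h k ∈ polydisk n
      · simp only [g, Set.indicator_of_mem hk, F]
        rw [ENNReal.ofReal_mul (by norm_num)]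
      · simp [g, hk]
    simp only [h2, uniformOn, lintegral_smul_measure]
    rw [lintegral_const_mul' _ _ ENNReal.ofReal_ne_top, hvol,
      ← ENNReal.ofReal_inv_of_pos hvpos, ← hWinv, smul_eq_mul, ENNReal.ofReal_mul hW0.le,
      div_eq_mul_inv, mul_comm x, ENNReal.ofReal_mul (by norm_num), one_div]
    gcongr
  · have e0 : (2 * singConst) ^ (latticeIndices h).card =
        ENNReal.ofReal ((2 * singConst).toReal ^ (latticeIndices h).card) := by
      rw [ENNReal.ofReal_pow (by positivity), ENNReal.ofReal_toReal hCtop]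
    rw [e0, ← ENNReal.ofReal_mul (Real.exp_pos _).le]
    refine ENNReal.ofReal_le_ofReal ?_
    have hcard := card_latticeIndices_le hpos hle
    rw [div_eq_mul_inv, ← hWinv] at hcard
    have hlog := Real.log_nonneg hC
    have e : (2 * singConst).toReal ^ (latticeIndices h).card =
        Real.exp ((latticeIndices h).card * Real.log (2 * singConst).toReal) := by
      rw [← Real.rpow_natCast, Real.rpow_def_of_pos (by linarith), mul_comm]
    rw [e, ← Real.exp_add]
    refine Real.exp_le_exp.2 ?_
    nlinarith [mul_le_mul_of_nonneg_right hcard hlog]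

/-! ### The density of the test form. -/

section Forms

variable {n k : ℕ}

theorem contDiff_extDeriv {φ : RealForm n k} {m : WithTop ℕ∞} (hφ : ContDiff ℝ (m + 1) φ) :
    ContDiff ℝ m (extDeriv φ) := by
  have h : extDeriv φ = fun x =>
      ContinuousAlternatingMap.alternatizeUncurryFinCLM ℝ (Fin n → ℂ) ℝ (fderiv ℝ φ x) := rfl
  rw [h]
  exact ContinuousLinearMap.contDiff _ |>.comp (hφ.fderiv_right le_rfl)

theorem contDiff_jPullback {η : RealForm n k} {m : WithTop ℕ∞} (hη : ContDiff ℝ m η) :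
    ContDiff ℝ m (jPullback η) := by
  let T : ((Fin n → ℂ) [⋀^Fin k]→L[ℝ] ℝ) →L[ℝ] ((Fin n → ℂ) [⋀^Fin k]→L[ℝ] ℝ) :=
    ContinuousAlternatingMap.compContinuousLinearMapCLM (mulI n)
  exact T.contDiff.comp hη

theorem continuous_iDDbar {φ : RealForm n k} (hφ : ContDiff ℝ 2 φ) : Continuous (iDDbar φ) := by
  have h : ContDiff ℝ 0 (extDeriv (jPullback (extDeriv φ))) :=
    contDiff_extDeriv (contDiff_jPullback (contDiff_extDeriv (by norm_num; exact hφ)))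
  have h' := h.continuous
  unfold iDDbar
  fun_prop

theorem iDDbar_eq_zero_of_notMem_tsupport {φ : RealForm n k} {z : Fin n → ℂ}
    (hz : z ∉ tsupport φ) : iDDbar φ z = 0 := by
  have h1 : φ =ᶠ[𝓝 z] 0 := notMem_tsupport_iff_eventuallyEq.1 hz
  have h0 : ∀ m, extDeriv (0 : RealForm n m) = 0 := by
    intro m
    ext x v
    have h : extDeriv (0 : RealForm n m) x =
        ContinuousAlternatingMap.alternatizeUncurryFinCLM ℝ (Fin n → ℂ) ℝ
          (fderiv ℝ (0 : RealForm n m) x) := rfl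
    rw [h, fderiv_zero, Pi.zero_apply, map_zero]
    rfl
  have h2 : extDeriv φ =ᶠ[𝓝 z] 0 := by
    have := h1.extDeriv
    rwa [h0] at this
  have h3 : jPullback (extDeriv φ) =ᶠ[𝓝 z] 0 := by
    filter_upwards [h2] with x hx
    simp only [jPullback, hx]
    rfl
  rw [iDDbar, h3.extDeriv_eq, h0]
  simp

end Forms

/-- `E log |ζ|²` for a standard complex Gaussian variable `ζ`. -/
def gaussLogMean : ℝ := ∫ w, Real.log (‖w‖ ^ 2) ∂stdComplexGaussian

/-- The function by which `log |f|²` is integrated in the linear statistic of `φ`, up to the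
factor `1 / 2π`. -/
def testDensity {n : ℕ} (φ : RealForm n (2 * (n - 1))) (z : Fin n → ℂ) : ℝ :=
  iDDbar φ z (stdFrame n _)

section Density

variable {n : ℕ} {φ : RealForm n (2 * (n - 1))}

theorem continuous_testDensity (hφ : IsTestForm φ) : Continuous (testDensity φ) :=
  (ContinuousAlternatingMap.apply ℝ (Fin n → ℂ) ℝ (stdFrame n _)).continuous.comp
    (continuous_iDDbar hφ.contDiff)

theorem support_testDensity_subset : Function.support (testDensity φ) ⊆ tsupport φ := by
  intro z hz
  by_contra h
  exact hz (by simp [testDensity, iDDbar_eq_zero_of_notMem_tsupport h])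

theorem exists_abs_testDensity_le (hφ : IsTestForm φ) :
    ∃ C, 0 < C ∧ ∀ z, |testDensity φ z| ≤ C := by
  have hc : HasCompactSupport (testDensity φ) :=
    hφ.hasCompactSupport.mono' support_testDensity_subset
  obtain ⟨C, hC⟩ := hc.exists_bound_of_continuous (continuous_testDensity hφ)
  refine ⟨max C 1, by positivity, fun z => (hC z).trans (le_max_left _ _)⟩

variable {L : Fin n → ℝ}

/-- The logarithm blows up at the boundary of the polydisk, but the density lives on a compact
subset of the interior, where the product is continuous. -/
theorem integrable_testDensity_mul_log_normFactor (hφ : IsTestForm φ) :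
    Integrable fun z => testDensity φ z * Real.log (normFactor L z) := by
  rw [← integrableOn_iff_integrable_of_support_subset (s := tsupport φ)
    ((Function.support_mul_subset_left _ _).trans support_testDensity_subset)]
  refine ContinuousOn.integrableOn_compact hφ.hasCompactSupport ?_
  refine (continuous_testDensity hφ).continuousOn.mul (ContinuousOn.log ?_ fun z hz =>
    (normFactor_pos (hφ.tsupport_subset hz)).ne')
  refine continuousOn_finsetProd _ fun j _ => ContinuousOn.rpow_const (by fun_prop) fun z hz => ?_
  left
  have := hφ.tsupport_subset hz j
  nlinarith [norm_nonneg (z j)]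

end Density

/-! ### The linear statistic and its deviation from the mean. -/

section Statistic

variable {n : ℕ} {φ : RealForm n (2 * (n - 1))} {L : Fin n → ℝ}
variable {Ω : Type*} [MeasurableSpace Ω] {P : Measure Ω} [IsProbabilityMeasure P]
  {a : (Fin n → ℕ) → Ω → ℂ}

omit [MeasurableSpace Ω] in
theorem linStat_eq (ω : Ω) : linStat a L φ ω = 1 / (2 * Real.pi) * ∫ z in polydisk n,
    Real.log (‖hyperbolicGAF L (fun α => a α ω) z‖ ^ 2) * testDensity φ z := rfl

theorem integrable_log_normGAF (hL : ∀ j, 0 < L j) (ha : IsIIDStdComplexGaussian a P) :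
    Integrable (fun q : (Fin n → ℂ) × Ω => Real.log (‖normGAF L (fun α => a α q.2) q.1‖ ^ 2))
      ((volume.restrict (polydisk n)).prod P) := by
  have hm := measurable_normGAF (L := L) ha.measurable
  have hm2 : Measurable fun q : (Fin n → ℂ) × Ω =>
    Real.log (‖normGAF L (fun α => a α q.2) q.1‖ ^ 2) := by fun_prop
  refine ⟨hm2.aestronglyMeasurable, ?_⟩
  rw [HasFiniteIntegral, lintegral_prod _ hm2.enorm.aemeasurable]
  have h : ∀ z ∈ polydisk n, ∫⁻ ω, ‖Real.log (‖normGAF L (fun α => a α ω) z‖ ^ 2)‖ₑ ∂P =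
      ∫⁻ w, ‖Real.log (‖w‖ ^ 2)‖ₑ ∂stdComplexGaussian := fun z hz =>
    lintegral_comp_normGAF hL ha hz (F := fun w => ‖Real.log (‖w‖ ^ 2)‖ₑ) (by fun_prop)
  rw [setLIntegral_congr_fun (measurableSet_polydisk n) h, setLIntegral_const]
  exact ENNReal.mul_lt_top integrable_log_norm_sq_stdComplexGaussian.2
    (volume_polydisk_ne_top n).lt_top

theorem integral_log_normGAF (hL : ∀ j, 0 < L j) (ha : IsIIDStdComplexGaussian a P)
    {z : Fin n → ℂ} (hz : z ∈ polydisk n) :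
    ∫ ω, Real.log (‖normGAF L (fun α => a α ω) z‖ ^ 2) ∂P = gaussLogMean := by
  rw [gaussLogMean, ← map_normGAF hL ha hz, integral_map]
  · exact ((measurable_normGAF ha.measurable).comp
      (measurable_const.prodMk measurable_id)).aemeasurable
  · exact (by fun_prop : Measurable fun w : ℂ => Real.log (‖w‖ ^ 2)).aestronglyMeasurable

/-- By Fubini it suffices to fix the point, where the law is absolutely continuous. This is needed
to split the logarithm of the product. -/
theorem ae_normGAF_ne_zero (hL : ∀ j, 0 < L j) (ha : IsIIDStdComplexGaussian a P) :
    ∀ᵐ q ∂((volume.restrict (polydisk n)).prod P), normGAF L (fun α => a α q.2) q.1 ≠ 0 := by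
  have hm := measurable_normGAF (L := L) ha.measurable
  rw [Measure.ae_prod_iff_ae_ae (p := fun q => normGAF L (fun α => a α q.2) q.1 ≠ 0)
    (hm (measurableSet_singleton 0).compl)]
  filter_upwards [ae_restrict_mem (measurableSet_polydisk n)] with z hz
  have h0 : ∀ᵐ w ∂stdComplexGaussian, w ≠ 0 := by
    exact (withDensity_absolutelyContinuous _ _).ae_le
      (compl_mem_ae_iff.2 (measure_singleton (0 : ℂ)))
  rw [← map_normGAF hL ha hz] at h0
  exact ae_of_ae_map ((hm.comp (measurable_const.prodMk measurable_id)).aemeasurable) h0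

omit [MeasurableSpace Ω] in
theorem log_hyperbolicGAF {ω : Ω} {z : Fin n → ℂ} (hz : z ∈ polydisk n)
    (h : normGAF L (fun α => a α ω) z ≠ 0) :
    Real.log (‖hyperbolicGAF L (fun α => a α ω) z‖ ^ 2) =
      Real.log (‖normGAF L (fun α => a α ω) z‖ ^ 2) - 2 * Real.log (normFactor L z) := by
  rw [normGAF_eq] at h ⊢
  have h1 := left_ne_zero_of_mul h
  have h2 : 0 < normFactor L z := normFactor_pos hz
  rw [norm_mul, Complex.norm_real, Real.norm_of_nonneg h2.le, Real.log_pow, Real.log_pow,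
    Real.log_mul (norm_ne_zero_iff.2 h1) h2.ne']
  push_cast; ring

/-- The deviation of the linear statistic, as an integral of the normalized potential. -/
theorem integrable_linStat_and_deviation (hφ : IsTestForm φ) (hL : ∀ j, 0 < L j)
    (ha : IsIIDStdComplexGaussian a P) :
    Integrable (linStat a L φ) P ∧ ∀ᵐ ω ∂P,
      IntegrableOn (fun z => Real.log (‖normGAF L (fun α => a α ω) z‖ ^ 2)) (polydisk n) ∧
      linStat a L φ ω - ∫ ω', linStat a L φ ω' ∂P = 1 / (2 * Real.pi) * ∫ z in polydisk n,
        (Real.log (‖normGAF L (fun α => a α ω) z‖ ^ 2) - gaussLogMean) * testDensity φ z := by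
  have hψ := continuous_testDensity hφ
  obtain ⟨C, -, hC⟩ := exists_abs_testDensity_le hφ
  have hfin : IsFiniteMeasure (volume.restrict (polydisk n)) :=
    ⟨by simpa using (volume_polydisk_ne_top n).lt_top⟩
  have hX := integrable_log_normGAF hL ha
  have hN : Integrable (fun z => 2 * (testDensity φ z * Real.log (normFactor L z)))
      (volume.restrict (polydisk n)) :=
    (integrable_testDensity_mul_log_normFactor hφ).integrableOn.const_mul 2
  have hXψ : Integrable (fun q : (Fin n → ℂ) × Ω =>
      Real.log (‖normGAF L (fun α => a α q.2) q.1‖ ^ 2) * testDensity φ q.1)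
      ((volume.restrict (polydisk n)).prod P) :=
    hX.mul_bdd (c := C) (hψ.measurable.comp measurable_fst).aestronglyMeasurable
      (ae_of_all _ fun q => hC q.1)
  have hJ : Integrable (fun q : (Fin n → ℂ) × Ω =>
      Real.log (‖normGAF L (fun α => a α q.2) q.1‖ ^ 2) * testDensity φ q.1 -
        2 * (testDensity φ q.1 * Real.log (normFactor L q.1)))
      ((volume.restrict (polydisk n)).prod P) := hXψ.sub (hN.comp_fst P)
  have hmem : ∀ᵐ q ∂((volume.restrict (polydisk n)).prod P), q.1 ∈ polydisk n :=
    Measure.quasiMeasurePreserving_fst.ae (ae_restrict_mem (measurableSet_polydisk n))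
  have heq : ∀ᵐ q ∂((volume.restrict (polydisk n)).prod P),
      Real.log (‖hyperbolicGAF L (fun α => a α q.2) q.1‖ ^ 2) * testDensity φ q.1 =
      Real.log (‖normGAF L (fun α => a α q.2) q.1‖ ^ 2) * testDensity φ q.1 -
        2 * (testDensity φ q.1 * Real.log (normFactor L q.1)) := by
    filter_upwards [hmem, ae_normGAF_ne_zero hL ha] with q h1 h2
    rw [log_hyperbolicGAF h1 h2]; ring
  have hswap : ∀ {p : (Fin n → ℂ) × Ω → Prop},
      (∀ᵐ q ∂((volume.restrict (polydisk n)).prod P), p q) →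
      ∀ᵐ ω ∂P, ∀ᵐ z ∂(volume.restrict (polydisk n)), p (z, ω) := fun h =>
    Measure.ae_ae_of_ae_prod (Measure.measurePreserving_swap.quasiMeasurePreserving.ae h)
  have hlin : linStat a L φ =ᵐ[P] fun ω => 1 / (2 * Real.pi) * ∫ z in polydisk n,
      (Real.log (‖normGAF L (fun α => a α ω) z‖ ^ 2) * testDensity φ z -
        2 * (testDensity φ z * Real.log (normFactor L z))) := by
    filter_upwards [hswap heq] with ω hω
    rw [linStat_eq, integral_congr_ae hω]
  refine ⟨(hJ.integral_prod_right.const_mul _).congr hlin.symm, ?_⟩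
  -- Fubini and the one-point law give the mean; its `normFactor` term is the same as in `hlin`,
  -- hence cancels in the deviation.
  have hE : ∫ ω, linStat a L φ ω ∂P = 1 / (2 * Real.pi) * ((∫ z in polydisk n,
      gaussLogMean * testDensity φ z) - ∫ z in polydisk n,
        2 * (testDensity φ z * Real.log (normFactor L z))) := by
    rw [integral_congr_ae hlin, integral_const_mul, integral_integral_swap (by
      exact hJ.swap), ← integral_sub _ hN]
    · congr 1
      refine setIntegral_congr_fun (measurableSet_polydisk n) fun z hz => ?_
      have hXz : Integrable (fun ω => Real.log (‖normGAF L (fun α => a α ω) z‖ ^ 2)) P := by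
        have := integrable_log_norm_sq_stdComplexGaussian
        rw [← map_normGAF hL ha hz] at this
        exact this.comp_measurable ((measurable_normGAF ha.measurable).comp
          (measurable_const.prodMk measurable_id))
      rw [integral_sub (hXz.mul_const _) (integrable_const _), integral_mul_const,
        integral_log_normGAF hL ha hz]
      simp
    · refine Integrable.const_mul ?_ _
      exact Integrable.of_bound hψ.aestronglyMeasurable C (ae_of_all _ hC)
  filter_upwards [hlin, hX.prod_left_ae, hXψ.prod_left_ae] with ω h1 h2 h3
  refine ⟨h2, ?_⟩
  have hc : Integrable (fun z => gaussLogMean * testDensity φ z)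
      (volume.restrict (polydisk n)) :=
    Integrable.const_mul (Integrable.of_bound hψ.aestronglyMeasurable C (ae_of_all _ hC)) _
  simp only [sub_mul]
  rw [h1, hE, integral_sub h3 hN, integral_sub h3 hc]
  ring

theorem abs_deviation_le (hφ : IsTestForm φ) (hL : ∀ j, 0 < L j)
    (ha : IsIIDStdComplexGaussian a P) {C : ℝ} (hC : ∀ z, |testDensity φ z| ≤ C)
    {x : ℝ} (hx : 0 ≤ x) : ∀ᵐ ω ∂P,
      ∫⁻ z in polydisk n, ENNReal.ofReal (max 0 (Real.log
        (‖normGAF L (fun α => a α ω) z‖ ^ 2))) < ENNReal.ofReal x →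
      ∫⁻ z in polydisk n, ENNReal.ofReal (max 0 (-Real.log
        (‖normGAF L (fun α => a α ω) z‖ ^ 2))) < ENNReal.ofReal x →
      |linStat a L φ ω - ∫ ω', linStat a L φ ω' ∂P| ≤
        C * (2 * x + |gaussLogMean| * (volume (polydisk n)).toReal) := by
  have hfin : IsFiniteMeasure (volume.restrict (polydisk n)) :=
    ⟨by simpa using (volume_polydisk_ne_top n).lt_top⟩
  have hC0 : 0 ≤ C := (abs_nonneg _).trans (hC 0)
  filter_upwards [(integrable_linStat_and_deviation hφ hL ha).2] with ω ⟨hint, hdev⟩ h1 h2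
  set u : (Fin n → ℂ) → ℝ := fun z => Real.log (‖normGAF L (fun α => a α ω) z‖ ^ 2) with hu
  have hp : Integrable (fun z => max 0 (u z)) (volume.restrict (polydisk n)) :=
    (integrable_const 0).sup hint
  have hn : Integrable (fun z => max 0 (-u z)) (volume.restrict (polydisk n)) :=
    (integrable_const 0).sup hint.neg
  have h1' : ∫ z in polydisk n, max 0 (u z) ≤ x := by
    rw [integral_eq_lintegral_of_nonneg_ae (f := fun z => max 0 (u z))
      (ae_of_all _ fun z => le_max_left _ _) hp.1]
    exact ENNReal.toReal_le_of_le_ofReal hx h1.le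
  have h2' : ∫ z in polydisk n, max 0 (-u z) ≤ x := by
    rw [integral_eq_lintegral_of_nonneg_ae (f := fun z => max 0 (-u z))
      (ae_of_all _ fun z => le_max_left _ _) hn.1]
    exact ENNReal.toReal_le_of_le_ofReal hx h2.le
  have hpn : Integrable (fun z => max 0 (u z) + max 0 (-u z)) (volume.restrict (polydisk n)) :=
    hp.add hn
  have hs : Integrable (fun z => max 0 (u z) + max 0 (-u z) + |gaussLogMean|)
    (volume.restrict (polydisk n)) := hpn.add (integrable_const _)
  have hbound : |∫ z in polydisk n, (u z - gaussLogMean) * testDensity φ z| ≤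
      ∫ z in polydisk n, C * (max 0 (u z) + max 0 (-u z) + |gaussLogMean|) := by
    rw [← Real.norm_eq_abs]
    refine norm_integral_le_of_norm_le (hs.const_mul C)
      (ae_of_all _ fun z => ?_)
    rw [Real.norm_eq_abs, abs_mul, mul_comm]
    refine mul_le_mul (hC z) ?_ (abs_nonneg _) hC0
    refine (abs_sub _ _).trans ?_
    have : |u z| ≤ max 0 (u z) + max 0 (-u z) := by
      have e1 := le_max_left 0 (u z)
      have e2 := le_max_right 0 (u z)
      have e3 := le_max_left 0 (-u z)
      have e4 := le_max_right 0 (-u z)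
      exact abs_le.2 ⟨by linarith, by linarith⟩
    linarith
  have hpi : 1 / (2 * Real.pi) ≤ 1 := by
    rw [div_le_one (by positivity)]; linarith [Real.pi_gt_three]
  rw [hdev, abs_mul, abs_of_nonneg (by positivity)]
  refine (mul_le_of_le_one_left (abs_nonneg _) hpi).trans (hbound.trans ?_)
  rw [integral_const_mul, integral_add hpn (integrable_const _), integral_add hp hn,
    setIntegral_const, smul_eq_mul, Measure.real]
  refine mul_le_mul_of_nonneg_left ?_ hC0
  linarith

end Statistic

/-! ### Choice of parameters and conclusion. -/

theorem one_add_two_mul_pow_factorial_le {p : ℕ} (hp : 1 ≤ p) :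
    (1 + 2 * (2 ^ p * p.factorial) : ℝ) ≤ (6 * p) ^ p := by
  have h1 : (p.factorial : ℝ) ≤ (p : ℝ) ^ p := by exact_mod_cast Nat.factorial_le_pow p
  have hp' : (1 : ℝ) ≤ p := by exact_mod_cast hp
  have h2 : (1 : ℝ) ≤ (2 * p) ^ p := one_le_pow₀ (by linarith)
  have h3 : (3 : ℝ) ≤ 3 ^ p := by simpa using pow_le_pow_right₀ (by norm_num : (1 : ℝ) ≤ 3) hp
  calc (1 + 2 * (2 ^ p * p.factorial) : ℝ) ≤ (2 * p) ^ p + 2 * (2 ^ p * (p : ℝ) ^ p) := by gcongr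
    _ = 3 * (2 * p) ^ p := by rw [mul_pow]; ring
    _ ≤ 3 ^ p * (2 * p) ^ p := by gcongr
    _ = (6 * p) ^ p := by rw [← mul_pow]; ring

theorem exists_pow_le_exp_mul (n : ℕ) {b : ℝ} (hb : 0 < b) :
    ∃ S : ℝ, ∀ s, S ≤ s → 12 * s ^ n ≤ Real.exp (b * s) := by
  have h := isLittleO_pow_exp_pos_mul_atTop n hb
  have h2 := h.def (c := 1 / 12) (by norm_num)
  obtain ⟨S, hS⟩ := eventually_atTop.1 h2
  refine ⟨max S 0, fun s hs => ?_⟩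
  have h3 := hS s ((le_max_left _ _).trans hs)
  have h4 : 0 ≤ s := (le_max_right _ _).trans hs
  rw [Real.norm_of_nonneg (by positivity), Real.norm_of_nonneg (Real.exp_pos _).le] at h3
  linarith

/-- Large deviations of the linear statistic, at the scale of the total intensity. -/
theorem exists_linStat_deviation_le {n : ℕ} (hn : 1 ≤ n) {φ : RealForm n (2 * (n - 1))}
    (hφ : IsTestForm φ) {δ : ℝ} (hδ : 0 < δ) :
    ∃ c : ℝ, 0 < c ∧ ∃ L₀ : Fin n → ℝ, ∀ L : Fin n → ℝ, (∀ j, L₀ j ≤ L j) →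
      ∀ (Ω : Type*) [MeasurableSpace Ω] (P : Measure Ω) [IsProbabilityMeasure P]
        (a : (Fin n → ℕ) → Ω → ℂ), IsIIDStdComplexGaussian a P →
        Integrable (linStat a L φ) P ∧
        P.real {ω | δ * ∑ j, L j < |linStat a L φ ω - ∫ ω', linStat a L φ ω' ∂P|}
          ≤ Real.exp (-(c * (∑ j, L j) * ∏ j, L j)) := by
  obtain ⟨C, hC0, hC⟩ := exists_abs_testDensity_le hφ
  obtain ⟨M, hM0, A, hneg⟩ := measure_negLog_ge_le n
  set V := (volume (polydisk n)).toReal with hVdef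
  have hV : 0 < V := ENNReal.toReal_pos (volume_polydisk_pos n).ne' (volume_polydisk_ne_top n)
  -- Two tails at level `ε s` contribute `2 C ε s = δ s / 2`, leaving `δ s / 2` for the constant
  -- term with `gaussLogMean`.
  set ε := δ / (4 * C) with hε
  have hε0 : 0 < ε := by positivity
  set N := (M ^ 2) ^ n with hN
  have hN0 : 0 < N := by positivity
  set c := min (ε / (4 * V)) (ε / (8 * N)) with hc
  have hc0 : 0 < c := lt_min (by positivity) (by positivity)
  have hcV : c ≤ ε / (4 * V) := min_le_left _ _
  have hcN : c ≤ ε / (8 * N) := min_le_right _ _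
  obtain ⟨S, hS⟩ := exists_pow_le_exp_mul n (b := ε / (2 * V)) (by positivity)
  -- The four thresholds on `s` absorb, in order: the moment `(6p)^p`, the constant `A`, the
  -- Gaussian log mean, and the factor `2` from the union bound.
  set S₁ := max (max S (4 * A / ε)) (max (2 * C * |gaussLogMean| * V / δ) (Real.log 2 / c))
  refine ⟨c, hc0, fun _ => max (max 1 (M ^ 2)) S₁, fun L hL Ω _ P _ a ha => ?_⟩
  have hL1 : ∀ j, 1 ≤ L j := fun j => ((le_max_left _ _).trans (le_max_left _ _)).trans (hL j)
  have hLM : ∀ j, M ^ 2 ≤ L j := fun j =>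
    ((le_max_right _ _).trans (le_max_left _ _)).trans (hL j)
  have hL0 : ∀ j, 0 < L j := fun j => one_pos.trans_le (hL1 j)
  have hLs : ∀ j, L j ≤ ∑ i, L i := fun j =>
    Finset.single_le_sum (fun i _ => (hL0 i).le) (Finset.mem_univ j)
  have hsS : S₁ ≤ ∑ j, L j :=
    ((le_max_right _ _).trans (hL ⟨0, hn⟩)).trans (hLs _)
  have hs1 : 1 ≤ ∑ j, L j := (hL1 ⟨0, hn⟩).trans (hLs _)
  have hR1 : 1 ≤ ∏ j, L j := by
    simpa using Finset.prod_le_prod (s := Finset.univ) (f := fun _ : Fin n => (1 : ℝ))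
      (fun _ _ => zero_le_one) fun j _ => hL1 j
  have hRs : ∏ j, L j ≤ (∑ j, L j) ^ n := by
    calc ∏ j, L j ≤ ∏ _j : Fin n, ∑ i, L i :=
          Finset.prod_le_prod (fun j _ => (hL0 j).le) fun j _ => hLs j
      _ = (∑ j, L j) ^ n := by simp
  set s := ∑ j, L j with hs
  set R := ∏ j, L j with hR
  have hs_S : S ≤ s := ((le_max_left _ _).trans (le_max_left _ _)).trans hsS
  have hs_A : 4 * A / ε ≤ s := ((le_max_right _ _).trans (le_max_left _ _)).trans hsS
  have hs_C : 2 * C * |gaussLogMean| * V / δ ≤ s :=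
    ((le_max_left _ _).trans (le_max_right _ _)).trans hsS
  have hs_2 : Real.log 2 / c ≤ s := ((le_max_right _ _).trans (le_max_right _ _)).trans hsS
  rw [div_le_iff₀ hε0] at hs_A
  rw [div_le_iff₀ hδ] at hs_C
  rw [div_le_iff₀ hc0] at hs_2
  have hx0 : 0 ≤ ε * s := by positivity
  refine ⟨(integrable_linStat_and_deviation hφ hL0 ha).1, ?_⟩
  have hsub : P {ω | δ * s < |linStat a L φ ω - ∫ ω', linStat a L φ ω' ∂P|} ≤
      P {ω | ENNReal.ofReal (ε * s) ≤ ∫⁻ z in polydisk n,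
        ENNReal.ofReal (max 0 (Real.log (‖normGAF L (fun α => a α ω) z‖ ^ 2)))} +
      P {ω | ENNReal.ofReal (ε * s) ≤ ∫⁻ z in polydisk n,
        ENNReal.ofReal (max 0 (-Real.log (‖normGAF L (fun α => a α ω) z‖ ^ 2)))} := by
    refine le_trans (measure_mono_ae ?_) (measure_union_le _ _)
    filter_upwards [abs_deviation_le hφ hL0 ha hC hx0] with ω hω
    intro hdev
    by_contra hnot
    have hnot' := not_or.1 hnot
    have h1 := hω (not_le.1 hnot'.1) (not_le.1 hnot'.2)
    have h2 : δ * s < |linStat a L φ ω - ∫ ω', linStat a L φ ω' ∂P| := hdev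
    have h3 : C * (2 * (ε * s)) = δ * s / 2 := by rw [hε]; field_simp; norm_num
    nlinarith
  -- The exponent `p ≈ ∏ L_j` gives the decay rate `p · ε s`, of order `s R`.
  have hp := measure_posLog_ge_le hL0 ha (p := ⌈R⌉₊) hx0
  have hq := hneg L hL0 hLM Ω P a ha (ε * s) hx0
  have hp1 : 1 ≤ ⌈R⌉₊ := Nat.one_le_ceil_iff.2 (by linarith)
  have hpR : R ≤ ⌈R⌉₊ := Nat.le_ceil R
  have hpR2 : (⌈R⌉₊ : ℝ) ≤ 2 * R := by
    have := Nat.ceil_lt_add_one (show 0 ≤ R by linarith)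
    linarith
  have hT1 : Real.exp (-(⌈R⌉₊ * (ε * s) / V)) * (1 + 2 * (2 ^ ⌈R⌉₊ * ⌈R⌉₊.factorial)) ≤
      Real.exp (-(2 * (c * s * R))) := by
    -- Uses `6p ≤ 12 R ≤ 12 s^n ≤ exp(ε s / (2V))`, so the moment costs only half of the exponent.
    have h1 : (6 * (⌈R⌉₊ : ℝ)) ^ ⌈R⌉₊ ≤ Real.exp (⌈R⌉₊ * (ε / (2 * V) * s)) := by
      rw [Real.exp_nat_mul]
      refine pow_le_pow_left₀ (by positivity) (le_trans ?_ (hS s hs_S)) _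
      linarith
    refine (mul_le_mul_of_nonneg_left ((one_add_two_mul_pow_factorial_le hp1).trans h1)
      (Real.exp_pos _).le).trans ?_
    rw [← Real.exp_add]
    refine Real.exp_le_exp.2 ?_
    have h2 : -((⌈R⌉₊ : ℝ) * (ε * s) / V) + ⌈R⌉₊ * (ε / (2 * V) * s) =
        -(2 * (ε / (4 * V) * s * ⌈R⌉₊)) := by
      field_simp; ring
    rw [h2]
    have h3 : c * s * R ≤ ε / (4 * V) * s * ⌈R⌉₊ := by gcongr
    linarith
  have hT2 : Real.exp ((A - ε * s / 2) * (R / N)) ≤ Real.exp (-(2 * (c * s * R))) := by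
    refine Real.exp_le_exp.2 ?_
    have h1 : A - ε * s / 2 ≤ -(ε * s / 4) := by linarith
    have h2 : (A - ε * s / 2) * (R / N) ≤ -(ε * s / 4) * (R / N) :=
      mul_le_mul_of_nonneg_right h1 (by positivity)
    have h3 : -(ε * s / 4) * (R / N) = -(2 * (ε / (8 * N) * s * R)) := by field_simp; ring
    have h4 : c * s * R ≤ ε / (8 * N) * s * R := by gcongr
    linarith
  have hfinal : 2 * Real.exp (-(2 * (c * s * R))) ≤ Real.exp (-(c * s * R)) := by
    have h1 : Real.log 2 ≤ c * s * R := by nlinarith [mul_pos hc0 (one_pos.trans_le hs1)]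
    calc 2 * Real.exp (-(2 * (c * s * R))) = Real.exp (Real.log 2 + -(2 * (c * s * R))) := by
          rw [Real.exp_add, Real.exp_log two_pos]
      _ ≤ Real.exp (-(c * s * R)) := Real.exp_le_exp.2 (by linarith)
  refine ENNReal.toReal_le_of_le_ofReal (Real.exp_pos _).le ?_
  refine hsub.trans ((add_le_add (hp.trans (ENNReal.ofReal_le_ofReal hT1))
    (hq.trans (ENNReal.ofReal_le_ofReal hT2))).trans ?_)
  rw [← ENNReal.ofReal_add (Real.exp_pos _).le (Real.exp_pos _).le, ← two_mul]
  exact ENNReal.ofReal_le_ofReal hfinal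

end PolydiskGAF

end

theorem theorem2 (n : ℕ) (hn : 1 ≤ n) (φ : PolydiskGAF.RealForm n (2 * (n - 1)))
    (hφ : PolydiskGAF.IsTestForm φ) (δ : ℝ) (hδ : 0 < δ) :
    (∃ c : ℝ, 0 < c ∧ ∃ L₀ : Fin n → ℝ, ∀ L : Fin n → ℝ, (∀ j, L₀ j ≤ L j) →
      ∀ (Ω : Type*) [MeasurableSpace Ω] (P : Measure Ω) [IsProbabilityMeasure P]
        (a : (Fin n → ℕ) → Ω → ℂ), PolydiskGAF.IsIIDStdComplexGaussian a P →
        Integrable (PolydiskGAF.linStat a L φ) P ∧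
        P.real {ω | δ * ∑ j, L j <
            |PolydiskGAF.linStat a L φ ω - ∫ ω', PolydiskGAF.linStat a L φ ω' ∂P|}
          ≤ Real.exp (-(c * (∑ j, L j) * ∏ j, L j))) ∧
    (∀ κ : ℝ, 0 < κ →
      ∃ c : ℝ, 0 < c ∧ ∃ L₀ : Fin n → ℝ, ∀ L : Fin n → ℝ, (∀ j, L₀ j ≤ L j) →
      ∀ (Ω : Type*) [MeasurableSpace Ω] (P : Measure Ω) [IsProbabilityMeasure P]
        (a : (Fin n → ℕ) → Ω → ℂ), PolydiskGAF.IsIIDStdComplexGaussian a P →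
        κ * ∑ j, L j ≤ ∫ ω', PolydiskGAF.linStat a L φ ω' ∂P →
        P.real {ω | δ * ∫ ω', PolydiskGAF.linStat a L φ ω' ∂P <
            |PolydiskGAF.linStat a L φ ω - ∫ ω', PolydiskGAF.linStat a L φ ω' ∂P|}
          ≤ Real.exp (-(c * (∑ j, L j) * ∏ j, L j))) := by
  refine ⟨PolydiskGAF.exists_linStat_deviation_le hn hφ hδ, fun κ hκ => ?_⟩
  -- At level `δκ` the threshold `δκ ∑ L_j` is at most `δ` times the mean, so the event of (ii) lies
  -- inside that of (i).
  obtain ⟨c, hc, L₀, h⟩ := PolydiskGAF.exists_linStat_deviation_le hn hφ (mul_pos hδ hκ)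
  refine ⟨c, hc, L₀, fun L hL Ω _ P _ a ha hE => le_trans ?_ (h L hL Ω P a ha).2⟩
  refine measureReal_mono fun ω hω => ?_
  rw [Set.mem_ofPred_eq] at hω ⊢
  refine lt_of_le_of_lt ?_ hω
  rw [mul_assoc]
  exact mul_le_mul_of_nonneg_left hE hδ.le
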